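/- All simplicial complexes are finite. A \emph{stacked $d$-sphere} is a simplicial complex obtained from the boundary complex of the $(d+1)$-simplex by finitely many (possibly zero) stellar subdivisions of facets, each with a new vertex. For $d\ge 1$, Walkup's class $\mathcal{K}(d)$ is the class of all combinatorial $d$-manifolds all of whose vertex links are stacked $(d-1)$-spheres. A simplicial complex is \emph{$2$-neighborly} if any two of its vertices are joined by an edge. A simplicial complex $K$ on $n$ vertices is \emph{tight} if, for its canonical embedding $|K|\subset\Delta^{n-1}\subset E^{n-1}$ as a subcomplex of the $(n-1)$-simplex with the same $n$ vertices, the homomorphism $$H_i(|K|\cap h;\mathbb{F}_2)\longrightarrow H_i(|K|;\mathbb{F}_2)$$ induced by the inclusion is injective for every open or closed half-space $h\subset E^{n-1}$ and every $i\ge 0$. \textbf{Theorem.} Let $d=2$ or $d\geq 4$. Then every $2$-neighborly member of $\mathcal{K}(d)$ is tight. -/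

import Mathlib

/-! ### Abstract simplicial complexes: links, stellar subdivisions, stacked spheres

A simplicial complex with vertex set exactly `V` is Mathlib's `AbstractSimplicialComplex V` (faces
are nonempty finite sets, every singleton is a face).  Links and the spheres below only use some of
the elements of `V` as vertices, so they are `PreAbstractSimplicialComplex V`. -/

namespace Walkup

section Combinatorics

variable {V : Type} [DecidableEq V]

/-- The boundary complex `∂A` of the simplex with vertex set `A`: all nonempty proper subsets. -/
def simplexBoundary (A : Finset V) : PreAbstractSimplicialComplex V where
  faces := {s | s.Nonempty ∧ s ⊂ A}
  isRelLowerSet_faces := fun _ hs =>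
    ⟨hs.1, fun _ hts ht => ⟨ht, lt_of_le_of_lt hts hs.2⟩⟩

/-- The link `lk(v)` of a vertex `v`: all nonempty `s` with `v ∉ s` and `s ∪ {v}` a face. -/
def link (K : AbstractSimplicialComplex V) (v : V) : PreAbstractSimplicialComplex V where
  faces := {s | s.Nonempty ∧ v ∉ s ∧ insert v s ∈ K.faces}
  isRelLowerSet_faces := fun _ hs =>
    ⟨hs.1, fun _ hts ht => ⟨ht, fun hv => hs.2.1 (hts hv),
      (K.isRelLowerSet_faces hs.2.2).2 (Finset.insert_subset_insert v hts)
        (Finset.insert_nonempty _ _)⟩⟩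

/-- The stellar subdivision of `S` at the face `σ` with the new vertex `w`: the faces containing `σ`
are removed, and the cone with apex `w` over `{ρ | ρ ⊉ σ, ρ ∪ σ ∈ S}` (including `ρ = ∅`) is
inserted.  If `σ` is a facet of `S`, this replaces `σ` by the cone over `∂σ` with apex `w`. -/
def stellarSubdivision (S : PreAbstractSimplicialComplex V) (σ : Finset V) (w : V) :
    PreAbstractSimplicialComplex V where
  faces := {τ | τ ∈ S.faces ∧ ¬ σ ⊆ τ} ∪ {τ | ∃ ρ, ¬ σ ⊆ ρ ∧ ρ ∪ σ ∈ S.faces ∧ τ = insert w ρ}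
  isRelLowerSet_faces := by
    rintro τ (⟨hτ, hσ⟩ | ⟨ρ, hσ, hρ, rfl⟩)
    · exact ⟨(S.isRelLowerSet_faces hτ).1, fun t ht hne =>
        Or.inl ⟨(S.isRelLowerSet_faces hτ).2 ht hne, fun h => hσ (h.trans ht)⟩⟩
    · refine ⟨Finset.insert_nonempty _ _, fun t ht hne => ?_⟩
      have hsub : t.erase w ⊆ ρ := by
        rw [← Finset.subset_insert_iff]
        exact ht
      have hσne : σ.Nonempty := by
        rw [Finset.nonempty_iff_ne_empty]
        rintro rfl
        exact hσ (Finset.empty_subset _)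
      by_cases hw : w ∈ t
      · refine Or.inr ⟨t.erase w, fun h => hσ (h.trans hsub), ?_, (Finset.insert_erase hw).symm⟩
        exact (S.isRelLowerSet_faces hρ).2 (Finset.union_subset_union_left hsub)
          (hσne.mono Finset.subset_union_right)
      · rw [Finset.erase_eq_of_notMem hw] at hsub
        exact Or.inl ⟨(S.isRelLowerSet_faces hρ).2 (hsub.trans Finset.subset_union_left) hne,
          fun h => hσ (h.trans hsub)⟩

/-- Stacked `d`-spheres: the complexes obtained from the boundary complex of a `(d+1)`-simplex
(which has `d + 2` vertices) by finitely many stellar subdivisions of facets (faces with `d + 1`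
vertices) with new vertices. -/
inductive IsStackedSphere (d : ℕ) : PreAbstractSimplicialComplex V → Prop
  | boundary (A : Finset V) (hA : A.card = d + 2) : IsStackedSphere d (simplexBoundary A)
  | stack (S : PreAbstractSimplicialComplex V) (hS : IsStackedSphere d S)
      (σ : Finset V) (hσ : σ ∈ S.faces) (hcard : σ.card = d + 1)
      (w : V) (hw : {w} ∉ S.faces) : IsStackedSphere d (stellarSubdivision S σ w)

/-- Membership in Walkup's class `𝒦(d)`, for `d ≥ 1`: all vertex links are stacked
`(d-1)`-spheres.  Stacked spheres are PL spheres, so such a complex is automatically a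
combinatorial `d`-manifold. -/
def MemWalkupClass (d : ℕ) (K : AbstractSimplicialComplex V) : Prop :=
  1 ≤ d ∧ ∀ v : V, IsStackedSphere (d - 1) (link K v)

/-- `k`-neighborly: any at most `k` vertices span a face. -/
def IsNeighborly (k : ℕ) (K : AbstractSimplicialComplex V) : Prop :=
  ∀ s : Finset V, s.Nonempty → s.card ≤ k → s ∈ K.faces

end Combinatorics

/-! ### Tightness -/

/-- The inclusion `A ⊆ B` of subspaces of `E` induces an injective map
`H_i(A; F) → H_i(B; F)` in singular homology. -/
def HomologyInjective (F : Type) [Field F] {E : Type} [TopologicalSpace E] {A B : Set E}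
    (h : A ⊆ B) (i : ℕ) : Prop :=
  Function.Injective
    (((AlgebraicTopology.singularHomologyFunctor (ModuleCat.{0} F) i).obj (ModuleCat.of F F)).map
      (TopCat.ofHom (X := A) (Y := B) ⟨Set.inclusion h, continuous_inclusion h⟩)).hom

section Tight

variable {V : Type} [Fintype V]

/-- A subset `M` of the Euclidean space `ℝ^V` is `F`-tight: for every open or closed half-space `h`,
the map `H_i(M ∩ h; F) → H_i(M; F)` is injective for all `i`.  (Replacing a functional `φ` by `-φ`
gives the half-spaces on the other side of a hyperplane.) -/
def IsTightSubset (F : Type) [Field F] (M : Set (V → ℝ)) : Prop :=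
  ∀ (φ : (V → ℝ) →ₗ[ℝ] ℝ) (c : ℝ), φ ≠ 0 → ∀ i : ℕ,
    HomologyInjective F (Set.inter_subset_left : M ∩ {x | φ x < c} ⊆ M) i ∧
    HomologyInjective F (Set.inter_subset_left : M ∩ {x | φ x ≤ c} ⊆ M) i

/-- The canonical realization `|K| ⊆ Δ` of a complex with (finite) vertex set `V`, as a subcomplex of
the standard simplex `Δ = {x | x ≥ 0, ∑ x v = 1} ⊆ ℝ^V`: the union of the closed faces of `Δ` that
belong to `K`. -/
def realization (K : AbstractSimplicialComplex V) : Set (V → ℝ) :=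
  {x | x ∈ stdSimplex ℝ V ∧ ∃ s ∈ K.faces, ∀ v, v ∉ s → x v = 0}

/-- A complex `K` on `n` vertices is `F`-tight if its canonical embedding into the
`(n-1)`-simplex in `E^{n-1}` is.  Here `E^{n-1}` is the hyperplane `∑ x v = 1` of `ℝ^V`; its
half-spaces are the traces of the half-spaces of `ℝ^V` (the further traces are empty or everything,
where injectivity always holds). -/
def IsTightWrt (F : Type) [Field F] (K : AbstractSimplicialComplex V) : Prop :=
  IsTightSubset F (realization K)

/-- Tight means tight with respect to the field with two elements. -/
def IsTight (K : AbstractSimplicialComplex V) : Prop :=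
  IsTightWrt (ZMod 2) K

end Tight

end Walkup

/-!
# Two-neighborly members of Walkup's class are tight

All chains have coefficients in the field with two elements. Tightness is shown in the following
form: a singular chain of `|K| ∩ h` that bounds in `|K|` already bounds in `|K| ∩ h`.

**Simplicial part.** Let `W` be a set of vertices of `K` and `v ∉ W`. Passing from the induced
subcomplex `K[W]` to `K[W ∪ {v}]` attaches the cone over `lk(v)[W]`, so a cycle of `K[W]` dies only
if it is homologous to a cycle `f` of `lk(v)[W]`, and one has to see that `f` bounds in `K[W]`. The
link is a stacked `(d-1)`-sphere, and induction on the stacking shows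
(`IsStackedSphere.sphereLike`) that its induced subcomplexes have no homology in the dimensions
`1, …, d-3` and that its only top dimensional cycles are zero and the sum of all facets. If `f` has
dimension `0`, it bounds because `K` is 2-neighborly. If `f` has dimension between `1` and `d-3`,
it bounds in the link. If it has dimension `d-2 ≥ 2`, it bounds since `K[W]` has no homology in the
dimensions `2, …, d-2` (`exists_bd_eq_of_middle`), which follows by attaching one vertex at a time;
for `d = 3` the cycle `f` would be a 1-cycle of `K[W]`, which need not bound. If it has
dimension `d-1` and is not zero, it is the fundamental cycle of the link, `W` contains all vertices
but `v`, and `f` is the boundary of the sum of the facets of `K` avoiding `v`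
(`bd_allFaces_eq_zero`). The result is `exists_bd_eq_of_induced`.

**Reduction to simplicial chains.** Let `c` be a singular cycle of `|K| ∩ h` that bounds `e` in
`|K|`, and let `W` be the set of vertices in `h`. After barycentric subdivision all simplices are
small (`eventually_singSubdiv_mem`). Rounding each point to a vertex with a large coordinate, in `W`
whenever possible, turns small singular chains into ordered simplicial chains; by compactness `c`
becomes a chain of `K[W]` (`exists_pos_lower_bound`, `round_mem`). The simplicial statement shows
that the rounded cycle bounds in `K[W]`, and the straight line homotopy from `c` to its rounding
stays in `|K| ∩ h`, because small simplices lie in the open stars of their rounded vertices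
(`round_mem_face`). This is `exists_sbd_eq`.

Chains of simplices with `n` vertices, that is, of dimension `n - 1`, have index `n`. All complexes
are augmented by a generator in dimension `-1`, so that coning is a contraction throughout, and the
homotopies for reordering, for subdivision and for prisms are instances of one construction,
`coneHomotopy`.
-/

namespace Walkup

/-! ### Simplicial chains modulo two -/

section Chains

set_option linter.unusedSectionVars false

variable {V : Type} [Fintype V] [DecidableEq V]

/-- Simplicial chains modulo two of the full simplex on `V`, the empty simplex included. -/
abbrev SetChain (V : Type) : Type := Finset V → ZMod 2

theorem zmod_two_cases (x : ZMod 2) : x = 0 ∨ x = 1 := by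
  revert x; decide

/-- The boundary operator modulo two, augmented: the boundary of a vertex is the empty simplex. -/
def bd : SetChain V →ₗ[ZMod 2] SetChain V where
  toFun c t := ∑ v ∈ tᶜ, c (insert v t)
  map_add' c c' := by ext t; simp [Finset.sum_add_distrib]
  map_smul' a c := by ext t; simp [Finset.mul_sum]

theorem bd_apply (c : SetChain V) (t : Finset V) : bd c t = ∑ v ∈ tᶜ, c (insert v t) := rfl

/-- The cone with apex `v` over a chain; simplices containing `v` are sent to zero. -/
def cone (v : V) : SetChain V →ₗ[ZMod 2] SetChain V where
  toFun f t := if v ∈ t then f (t.erase v) else 0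
  map_add' c c' := by ext t; simp only [Pi.add_apply]; split_ifs <;> simp
  map_smul' a c := by ext t; simp

theorem cone_apply (v : V) (f : SetChain V) (t : Finset V) :
    cone v f t = if v ∈ t then f (t.erase v) else 0 := rfl

/-- The part of a chain formed by the simplices avoiding `v`. -/
def del (v : V) (z : SetChain V) : SetChain V := fun t => if v ∈ t then 0 else z t

/-- The link part of a chain: the simplices `t` avoiding `v`, weighted as `t ∪ {v}`. -/
def lk (v : V) (z : SetChain V) : SetChain V := fun t => if v ∈ t then 0 else z (insert v t)

theorem del_add_cone_lk (v : V) (z : SetChain V) : del v z + cone v (lk v z) = z := by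
  ext t
  by_cases h : v ∈ t <;> simp [del, lk, cone_apply, h]

theorem sum_compl_erase (v : V) (t : Finset V) (h : v ∈ t) (g : V → ZMod 2) :
    ∑ u ∈ (t.erase v)ᶜ, g u = g v + ∑ u ∈ tᶜ, g u := by
  rw [Finset.compl_erase, Finset.sum_insert (by simpa using h)]

theorem sum_compl_eq (v : V) (t : Finset V) (h : v ∉ t) (g : V → ZMod 2) :
    ∑ u ∈ tᶜ, g u = g v + ∑ u ∈ (insert v t)ᶜ, g u := by
  have := sum_compl_erase v (insert v t) (Finset.mem_insert_self _ _) g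
  rwa [Finset.erase_insert h] at this

/-- The cone operator is a contraction of the augmented complex. The formula needs no condition on
`f`, as simplices containing the apex cancel. -/
theorem bd_cone (v : V) (f : SetChain V) : bd (cone v f) = f + cone v (bd f) := by
  ext t
  by_cases h : v ∈ t
  · simp only [bd_apply, cone_apply, Pi.add_apply, h, Finset.mem_insert, or_true, if_true]
    rw [sum_compl_erase v t h, Finset.insert_erase h, ← add_assoc, CharTwo.add_self_eq_zero,
      zero_add]
    refine Finset.sum_congr rfl fun u hu => ?_
    rw [Finset.erase_insert_of_ne]
    rintro rfl
    simp [h] at hu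
  · simp only [bd_apply, cone_apply, Pi.add_apply, h, if_false, add_zero]
    rw [sum_compl_eq v t h]
    simp only [Finset.mem_insert_self, if_true, Finset.erase_insert h]
    rw [Finset.sum_eq_zero, add_zero]
    intro u hu
    simp only [Finset.compl_insert, Finset.mem_erase] at hu
    simp [h, Ne.symm hu.1]

theorem lk_bd (v : V) (z : SetChain V) : lk v (bd z) = bd (lk v z) := by
  ext t
  by_cases h : v ∈ t
  · simp [lk, bd_apply, h]
  · simp only [bd_apply, lk, h, if_false]
    rw [sum_compl_eq v t h]
    simp only [Finset.mem_insert_self, if_true, zero_add]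
    refine Finset.sum_congr rfl fun u hu => ?_
    simp only [Finset.compl_insert, Finset.mem_erase] at hu
    rw [if_neg (by simp [h, Ne.symm hu.1]), Finset.insert_comm]

theorem bd_del (v : V) (z : SetChain V) (h : lk v (bd z) = 0) :
    bd (del v z) = bd z + lk v z := by
  have h1 := congrArg bd (del_add_cone_lk v z)
  rw [map_add, bd_cone, ← lk_bd, h, map_zero, add_zero] at h1
  rw [← h1, add_assoc, ZModModule.add_self, add_zero]

theorem bd_bd (z : SetChain V) : bd (bd z) = 0 := by
  ext t
  simp only [bd_apply, Pi.zero_apply]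
  rw [Finset.sum_sigma']
  refine Finset.sum_involution (fun p _ => ⟨p.2, p.1⟩) ?_ ?_ ?_ ?_
  · rintro ⟨a, b⟩ _
    simp only [Finset.insert_comm a b]
    exact CharTwo.add_self_eq_zero _
  · rintro ⟨a, b⟩ hab _ h
    simp only [Finset.mem_sigma, Finset.mem_compl, Finset.mem_insert, not_or] at hab
    simp only [Sigma.mk.injEq, heq_eq_eq] at h
    exact hab.2.1 h.1
  · rintro ⟨a, b⟩ hab
    simp only [Finset.mem_sigma, Finset.mem_compl, Finset.mem_insert, not_or] at hab ⊢
    exact ⟨hab.2.2, fun h => hab.2.1 h.symm, hab.1⟩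
  · rintro ⟨a, b⟩ _
    rfl

/-- `c` is a chain of simplices with `k` vertices (dimension `k - 1`) belonging to the family `S`
and contained in the vertex set `W`. -/
def IsSetChain (S : Set (Finset V)) (W : Finset V) (k : ℕ) (c : SetChain V) : Prop :=
  ∀ s, c s ≠ 0 → s ∈ S ∧ s ⊆ W ∧ s.card = k

theorem IsSetChain.add {S : Set (Finset V)} {W : Finset V} {k : ℕ} {c c' : SetChain V}
    (h : IsSetChain S W k c) (h' : IsSetChain S W k c') : IsSetChain S W k (c + c') := by
  intro s hs
  by_cases h0 : c s = 0
  · exact h' s fun h1 => hs (by simp [h0, h1])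
  · exact h s h0

theorem IsSetChain.mono {S S' : Set (Finset V)} {W W' : Finset V} {k : ℕ} {c : SetChain V}
    (h : IsSetChain S W k c) (hS : ∀ s ∈ S, s ⊆ W → s.card = k → s ∈ S') (hW : W ⊆ W') :
    IsSetChain S' W' k c := fun s hs =>
  ⟨hS s (h s hs).1 (h s hs).2.1 (h s hs).2.2, (h s hs).2.1.trans hW, (h s hs).2.2⟩

theorem IsSetChain.cone {S S' : Set (Finset V)} {W W' : Finset V} {k : ℕ} {c : SetChain V} {v : V}
    (h : IsSetChain S W k c) (hv : v ∈ W') (hW : W ⊆ W')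
    (hS : ∀ s ∈ S, s ⊆ W → s.card = k → v ∉ s → insert v s ∈ S') :
    IsSetChain S' W' (k + 1) (cone v c) := by
  intro s hs
  rw [cone_apply] at hs
  split_ifs at hs with hvs
  · obtain ⟨h1, h2, h3⟩ := h _ hs
    have h4 := hS _ h1 h2 h3 (Finset.notMem_erase _ _)
    rw [Finset.insert_erase hvs] at h4
    refine ⟨h4, ?_, ?_⟩
    · rw [← Finset.insert_erase hvs]
      exact Finset.insert_subset hv (h2.trans hW)
    · rw [← h3, Finset.card_erase_add_one hvs]
  · exact absurd rfl hs

theorem IsSetChain.del {S : Set (Finset V)} {W : Finset V} {k : ℕ} {c : SetChain V} {v : V}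
    (h : IsSetChain S W k c) : IsSetChain {s ∈ S | v ∉ s} (W.erase v) k (del v c) := by
  intro s hs
  simp only [Walkup.del] at hs
  split_ifs at hs with hvs
  · exact absurd rfl hs
  · obtain ⟨h1, h2, h3⟩ := h _ hs
    exact ⟨⟨h1, hvs⟩, Finset.subset_erase.2 ⟨h2, hvs⟩, h3⟩

theorem IsSetChain.lk {S : Set (Finset V)} {W : Finset V} {k : ℕ} {c : SetChain V} {v : V}
    (h : IsSetChain S W (k + 1) c) :
    IsSetChain {s | v ∉ s ∧ insert v s ∈ S} (W.erase v) k (lk v c) := by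
  intro s hs
  simp only [Walkup.lk] at hs
  split_ifs at hs with hvs
  · exact absurd rfl hs
  · obtain ⟨h1, h2, h3⟩ := h _ hs
    rw [Finset.card_insert_of_notMem hvs] at h3
    exact ⟨⟨hvs, h1⟩, Finset.subset_erase.2 ⟨(Finset.subset_insert _ _).trans h2, hvs⟩,
      by omega⟩

theorem eq_bd_cone {f : SetChain V} (hf : bd f = 0) (v : V) : bd (cone v f) = f := by
  rw [bd_cone, hf, map_zero, add_zero]

/-- The simplices of a chain supported in the empty vertex set have no vertices. -/
theorem IsSetChain.eq_zero_of_empty {S : Set (Finset V)} {k : ℕ} {c : SetChain V}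
    (h : IsSetChain S ∅ (k + 1) c) : c = 0 := by
  ext s
  by_contra hs
  obtain ⟨-, h2, h3⟩ := h s hs
  rw [Finset.subset_empty.1 h2] at h3
  simp at h3

/-- A cycle of a simplex bounds a chain of one dimension more in the same simplex. -/
theorem exists_bd_eq_of_subset {S : Set (Finset V)} {W : Finset V} {k : ℕ} {f : SetChain V}
    (h : IsSetChain S W (k + 1) f) (hf : bd f = 0) :
    ∃ g, IsSetChain {s | s ⊆ W} W (k + 2) g ∧ bd g = f := by
  rcases W.eq_empty_or_nonempty with rfl | ⟨v, hv⟩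
  · refine ⟨0, fun s hs => absurd rfl hs, ?_⟩
    rw [h.eq_zero_of_empty, map_zero]
  · exact ⟨cone v f, h.cone hv subset_rfl fun s _ hs _ _ => Finset.insert_subset hv hs,
      eq_bd_cone hf v⟩

/-- The sum of all simplices of `S` with `k` vertices. -/
noncomputable def allFaces (S : Set (Finset V)) (k : ℕ) : SetChain V :=
  open Classical in fun t => if t ∈ S ∧ t.card = k then 1 else 0

theorem allFaces_ne_zero {S : Set (Finset V)} {k : ℕ} {s : Finset V} :
    allFaces S k s ≠ 0 ↔ s ∈ S ∧ s.card = k := by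
  classical
  simp [allFaces]

theorem allFaces_congr {S S' : Set (Finset V)} {k k' : ℕ} {s s' : Finset V}
    (h : s ∈ S ∧ s.card = k ↔ s' ∈ S' ∧ s'.card = k') : allFaces S k s = allFaces S' k' s' := by
  classical
  unfold allFaces
  split_ifs <;> tauto

theorem isSetChain_allFaces {S : Set (Finset V)} {k : ℕ} :
    IsSetChain S Finset.univ k (allFaces S k) := fun _ hs =>
  ⟨(allFaces_ne_zero.1 hs).1, Finset.subset_univ _, (allFaces_ne_zero.1 hs).2⟩

theorem bd_single_apply (A t : Finset V) :
    bd (Pi.single A 1) t = if t ⊆ A ∧ t.card + 1 = A.card then 1 else 0 := by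
  rw [bd_apply]
  split_ifs with h
  · obtain ⟨a, ha, rfl⟩ : ∃ a, a ∉ t ∧ insert a t = A := by
      obtain ⟨a, ha⟩ := Finset.card_eq_one.1 (show (A \ t).card = 1 by
        rw [Finset.card_sdiff_of_subset h.1]; omega)
      have : a ∈ A \ t := by simp [ha]
      refine ⟨a, (Finset.mem_sdiff.1 this).2, ?_⟩
      rw [Finset.insert_eq, ← ha, Finset.sdiff_union_of_subset h.1]
    rw [Finset.sum_eq_single a]
    · simp
    · intro b hb hba
      rw [Pi.single_eq_of_ne]
      intro hE
      have : b ∈ insert a t := hE ▸ Finset.mem_insert_self _ _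
      simp only [Finset.mem_compl] at hb
      simp [hba, hb] at this
    · simp [ha]
  · refine Finset.sum_eq_zero fun a ha => ?_
    rw [Pi.single_eq_of_ne]
    rintro rfl
    simp only [Finset.mem_compl] at ha
    exact h ⟨Finset.subset_insert _ _, by rw [Finset.card_insert_of_notMem ha]⟩

/-- A cycle of codimension one in a simplex is a multiple of the boundary of the simplex. -/
theorem eq_smul_bd_single {S : Set (Finset V)} {A : Finset V} {k : ℕ} {f : SetChain V}
    (hA : A.card = k + 2) (h : IsSetChain S A (k + 1) f) (hf : bd f = 0) :
    ∃ ε : ZMod 2, f = ε • bd (Pi.single A 1) := by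
  obtain ⟨g, hg, rfl⟩ := exists_bd_eq_of_subset h hf
  refine ⟨g A, ?_⟩
  rw [← map_smul]
  congr 1
  ext s
  by_cases hs : s = A
  · subst hs; simp
  · simp only [Pi.smul_apply, Pi.single_eq_of_ne hs, smul_zero]
    by_contra h0
    obtain ⟨-, h2, h3⟩ := hg s h0
    exact hs (Finset.eq_of_subset_of_card_le h2 (by omega))

end Chains

/-! ### Stacked spheres -/

section Stacked

set_option linter.unusedSectionVars false

variable {V : Type} [Fintype V] [DecidableEq V]

/-- The properties of a stacked `D`-sphere that matter for tightness: it is pure of dimension `D`,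
the sum of its facets is a cycle and the only nonzero top cycle, and its induced subcomplexes have
no homology in the dimensions from `1` to `D - 2`. -/
structure SphereLike (D : ℕ) (S : Set (Finset V)) : Prop where
  card_le : ∀ s ∈ S, s.card ≤ D + 1
  exists_facet : ∀ s ∈ S, ∃ t ∈ S, s ⊆ t ∧ t.card = D + 1
  bd_allFaces : bd (allFaces S (D + 1)) = 0
  top_cycle : ∀ z, IsSetChain S Finset.univ (D + 1) z → bd z = 0 →
    z = 0 ∨ z = allFaces S (D + 1)
  acyclic : ∀ W k z, 2 ≤ k → k + 1 ≤ D → IsSetChain S W k z → bd z = 0 →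
    ∃ g, IsSetChain S W (k + 1) g ∧ bd g = z

theorem sphereLike_boundary {D : ℕ} {A : Finset V} (hA : A.card = D + 2) :
    SphereLike D (simplexBoundary A).faces := by
  have hmem : ∀ s : Finset V, s ∈ (simplexBoundary A).faces ↔ s.Nonempty ∧ s ⊂ A := fun _ => Iff.rfl
  have hall : allFaces (simplexBoundary A).faces (D + 1) = bd (Pi.single A 1) := by
    classical
    ext s
    rw [bd_single_apply, allFaces]
    refine if_congr ?_ rfl rfl
    rw [hmem]
    constructor
    · rintro ⟨h1, h2⟩
      exact ⟨h1.2.subset, by omega⟩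
    · rintro ⟨h1, h2⟩
      have h3 : s.card = D + 1 := by omega
      refine ⟨⟨Finset.card_pos.1 (by omega), h1.ssubset_of_ne ?_⟩, h3⟩
      rintro rfl
      omega
  refine ⟨fun s hs => ?_, fun s hs => ?_, ?_, fun z hz hz0 => ?_, fun W k z hk hkD hz hz0 => ?_⟩
  · have := Finset.card_lt_card hs.2
    omega
  · obtain ⟨a, haA, has⟩ := Finset.exists_of_ssubset hs.2
    have h := Finset.card_erase_of_mem haA
    exact ⟨A.erase a, ⟨Finset.card_pos.1 (by omega), Finset.erase_ssubset haA⟩,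
      Finset.subset_erase.2 ⟨hs.2.subset, has⟩, by omega⟩
  · rw [hall, bd_bd]
  · have h : IsSetChain Set.univ A (D + 1) z := fun s hs =>
      ⟨trivial, (hz s hs).1.2.subset, (hz s hs).2.2⟩
    obtain ⟨ε, hε⟩ := eq_smul_bd_single hA h hz0
    rw [hall]
    rcases zmod_two_cases ε with rfl | rfl
    · left; simpa using hε
    · right; simpa using hε
  · obtain ⟨k, rfl⟩ := Nat.exists_eq_add_of_le' (show 1 ≤ k by omega)
    have h : IsSetChain Set.univ (W ∩ A) (k + 1) z := fun s hs =>
      ⟨trivial, Finset.subset_inter (hz s hs).2.1 (hz s hs).1.2.subset, (hz s hs).2.2⟩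
    obtain ⟨g, hg, hgz⟩ := exists_bd_eq_of_subset h hz0
    refine ⟨g, hg.mono (fun s _ hs hc => ?_) Finset.inter_subset_left, hgz⟩
    refine ⟨Finset.card_pos.1 (by omega),
      (hs.trans Finset.inter_subset_right).ssubset_of_ne ?_⟩
    rintro rfl
    omega

/-- Subdividing a facet `σ` replaces it by the cone over its boundary. -/
theorem mem_stellarSubdivision_iff {D : ℕ} {S : PreAbstractSimplicialComplex V} {σ : Finset V}
    {w : V} (hdim : ∀ s ∈ S.faces, s.card ≤ D + 1) (hσ : σ ∈ S.faces) (hcard : σ.card = D + 1)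
    (hw : {w} ∉ S.faces) (s : Finset V) :
    s ∈ (stellarSubdivision S σ w).faces ↔
      (s ∈ S.faces ∧ s ≠ σ) ∨ (w ∈ s ∧ s.erase w ⊂ σ) := by
  have hmax : ∀ t ∈ S.faces, σ ⊆ t → t = σ := fun t ht h =>
    (Finset.eq_of_subset_of_card_le h (by rw [hcard]; exact hdim t ht)).symm
  have hwS : ∀ t ∈ S.faces, w ∉ t := fun t ht hwt =>
    hw ((S.isRelLowerSet_faces ht).2 (Finset.singleton_subset_iff.2 hwt)
      (Finset.singleton_nonempty _))
  change ((s ∈ S.faces ∧ ¬ σ ⊆ s) ∨ (∃ ρ, ¬ σ ⊆ ρ ∧ ρ ∪ σ ∈ S.faces ∧ s = insert w ρ)) ↔ _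
  constructor
  · rintro (⟨h1, h2⟩ | ⟨ρ, h1, h2, rfl⟩)
    · exact Or.inl ⟨h1, fun h => h2 h.ge⟩
    · right
      have h3 := hmax _ h2 Finset.subset_union_right
      have h4 : ρ ⊆ σ := by rw [← h3]; exact Finset.subset_union_left
      refine ⟨Finset.mem_insert_self _ _, ?_⟩
      rw [Finset.erase_insert fun h => hwS σ hσ (h4 h)]
      exact ⟨h4, h1⟩
  · rintro (⟨h1, h2⟩ | ⟨h1, h2⟩)
    · exact Or.inl ⟨h1, fun h => h2 (hmax s h1 h)⟩
    · refine Or.inr ⟨s.erase w, h2.2, ?_, (Finset.insert_erase h1).symm⟩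
      rwa [Finset.union_eq_right.2 h2.1]

/-- Stacking preserves `SphereLike`. A cycle of the subdivided sphere is split into its part off the
new vertex `w` and a cone with apex `w` over a cycle of `∂σ`. Below the top dimension the latter
bounds in `∂σ`, which moves the cycle off `w`; in the top dimension it is a multiple of the boundary
of `σ`, which amounts to undoing the subdivision. -/
theorem sphereLike_stellarSubdivision {D : ℕ} (hD : 1 ≤ D) {S : PreAbstractSimplicialComplex V}
    (hS : SphereLike D S.faces) {σ : Finset V} {w : V} (hσ : σ ∈ S.faces)
    (hcard : σ.card = D + 1) (hw : {w} ∉ S.faces) :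
    SphereLike D (stellarSubdivision S σ w).faces := by
  have hmem := mem_stellarSubdivision_iff hS.card_le hσ hcard hw
  have hwS : ∀ t ∈ S.faces, w ∉ t := fun t ht hwt =>
    hw ((S.isRelLowerSet_faces ht).2 (Finset.singleton_subset_iff.2 hwt)
      (Finset.singleton_nonempty _))
  have hwσ := hwS σ hσ
  set S' := stellarSubdivision S σ w with hS'
  -- The sum of all facets changes by the boundary of the simplex on `σ ∪ {w}`.
  have hall : allFaces S'.faces (D + 1) = allFaces S.faces (D + 1) + Pi.single σ 1 +
      cone w (bd (Pi.single σ 1)) := by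
    ext s
    simp only [Pi.add_apply, cone_apply, bd_single_apply]
    by_cases hws : w ∈ s
    · have h1 : s ∉ S.faces := fun h => hwS s h hws
      have h2 : s ≠ σ := by rintro rfl; exact hwσ hws
      have h3 := Finset.card_erase_add_one hws
      simp only [allFaces, hmem, h1, hws, true_and, false_and, false_or, if_true, if_false,
        Pi.single_eq_of_ne h2, zero_add]
      refine if_congr ?_ rfl rfl
      constructor
      · rintro ⟨h4, h5⟩
        exact ⟨h4.subset, by omega⟩
      · rintro ⟨h4, h5⟩
        refine ⟨h4.ssubset_of_ne ?_, by omega⟩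
        intro h
        rw [h] at h5
        omega
    · have hm : s ∈ S'.faces ↔ s ∈ S.faces ∧ s ≠ σ := by rw [hmem]; simp [hws]
      simp only [hws, if_false, add_zero]
      by_cases h : s = σ
      · subst h
        simp [allFaces, hm, hσ, hcard, CharTwo.add_self_eq_zero]
      · rw [Pi.single_eq_of_ne h, add_zero]
        exact allFaces_congr (by simp [hm, h])
  -- A chain of `S'` splits into its part in `S` and the cone over a chain of `∂σ`.
  have hdel : ∀ {W k z}, IsSetChain S'.faces W k z →
      IsSetChain {s ∈ S.faces | s ≠ σ} (W.erase w) k (del w z) := by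
    intro W k z hz
    refine hz.del.mono (fun s hs _ _ => ?_) subset_rfl
    rcases (hmem s).1 hs.1 with h | h
    · exact h
    · exact absurd h.1 hs.2
  have hlk : ∀ {W k z}, IsSetChain S'.faces W (k + 1) z →
      IsSetChain {s | s ⊂ σ} (W.erase w ∩ σ) k (lk w z) := by
    intro W k z hz s hs
    obtain ⟨⟨h1, h2⟩, h3, h4⟩ := hz.lk s hs
    have h5 : s ⊂ σ := by
      rcases (hmem _).1 h2 with h | h
      · exact absurd (Finset.mem_insert_self _ _) (hwS _ h.1)
      · rw [Finset.erase_insert h1] at h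
        exact h.2
    exact ⟨h5, Finset.subset_inter h3 h5.subset, h4⟩
  have hlk0 : ∀ {z : SetChain V}, bd z = 0 → bd (lk w z) = 0 ∧ bd (del w z) = lk w z := by
    intro z hz
    have h0 : lk w (bd z) = 0 := by
      rw [hz]; ext t; simp [lk]
    exact ⟨by rw [← lk_bd, h0], by rw [bd_del w z h0, hz, zero_add]⟩
  -- Faces inside `σ ∪ {w}` lie in one of the new facets.
  have hnew : ∀ s, s.erase w ⊂ σ → ∃ t ∈ S'.faces, s ⊆ t ∧ t.card = D + 1 := by
    intro s hs
    obtain ⟨a, haσ, has⟩ := Finset.exists_of_ssubset hs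
    have h1 : w ∉ σ.erase a := fun h => hwσ (Finset.mem_of_mem_erase h)
    refine ⟨insert w (σ.erase a), (hmem _).2 (Or.inr ⟨Finset.mem_insert_self _ _, ?_⟩), ?_, ?_⟩
    · rw [Finset.erase_insert h1]
      exact Finset.erase_ssubset haσ
    · rw [← Finset.erase_subset_iff_of_mem (Finset.mem_insert_self _ _)] 
      exact (Finset.subset_erase.2 ⟨hs.subset, has⟩).trans (Finset.subset_insert _ _)
    · rw [Finset.card_insert_of_notMem h1, Finset.card_erase_add_one haσ, hcard]
  refine ⟨fun s hs => ?_, fun s hs => ?_, ?_, fun z hz hz0 => ?_, fun W k z hk hkD hz hz0 => ?_⟩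
  · rcases (hmem s).1 hs with h | h
    · exact hS.card_le s h.1
    · have h1 := Finset.card_lt_card h.2
      have h2 := Finset.card_erase_add_one h.1
      omega
  · rcases (hmem s).1 hs with h | h
    · obtain ⟨t, ht, hst, htc⟩ := hS.exists_facet s h.1
      by_cases htσ : t = σ
      · subst htσ
        refine hnew s ((Finset.erase_subset _ _).trans_ssubset (hst.ssubset_of_ne h.2))
      · exact ⟨t, (hmem t).2 (Or.inl ⟨ht, htσ⟩), hst, htc⟩
    · exact hnew s h.2
  · rw [hall, map_add, map_add, hS.bd_allFaces, bd_cone, bd_bd, map_zero, zero_add, add_zero,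
      ZModModule.add_self]
  · obtain ⟨hl0, hd0⟩ := hlk0 hz0
    obtain ⟨D, rfl⟩ := Nat.exists_eq_add_of_le' hD
    have hl := (hlk hz).mono (fun s hs _ _ => hs) (Finset.inter_subset_right (s₂ := σ))
    obtain ⟨ε, hε⟩ := eq_smul_bd_single hcard hl hl0
    -- Filling the hole with `ε • σ` gives a top cycle of `S`.
    have hy : IsSetChain S.faces Finset.univ (D + 1 + 1) (del w z + ε • Pi.single σ 1) := by
      refine IsSetChain.add ((hdel hz).mono (fun s hs _ _ => hs.1) (Finset.subset_univ _)) ?_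
      intro s hs
      by_cases h : s = σ
      · subst h; exact ⟨hσ, Finset.subset_univ _, hcard⟩
      · simp [h] at hs
    have hy0 : bd (del w z + ε • Pi.single σ 1) = 0 := by
      rw [map_add, map_smul, hd0, hε, ZModModule.add_self]
    have hzσ : del w z σ = 0 := by
      by_contra h
      exact (hdel hz σ h).1.2 rfl
    rcases hS.top_cycle _ hy hy0 with h | h
    · have hε0 : ε = 0 := by simpa [hzσ] using congrFun h σ
      left
      rw [← del_add_cone_lk w z, hε, hε0]
      simpa [hε0] using h
    · have hε1 : ε = 1 := by
        have := congrFun h σ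
        simpa [hzσ, allFaces, hσ, hcard] using this
      right
      have hz' := del_add_cone_lk w z
      rw [hε, hε1, one_smul] at hz'
      rw [hall, ← h, hε1, one_smul, add_assoc (del w z), ZModModule.add_self, add_zero, hz']
  · obtain ⟨k, rfl⟩ := Nat.exists_eq_add_of_le' hk
    obtain ⟨hl0, hd0⟩ := hlk0 hz0
    obtain ⟨g, hg, hgz, hgW⟩ : ∃ g, IsSetChain {s | s ⊆ W.erase w ∩ σ} (W.erase w ∩ σ) (k + 2) g ∧
        bd g = lk w z ∧ (w ∉ W → g = 0) := by
      by_cases hwW : w ∈ W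
      · obtain ⟨g, hg, hgz⟩ := exists_bd_eq_of_subset (hlk hz) hl0
        exact ⟨g, hg, hgz, fun h => absurd hwW h⟩
      · refine ⟨0, fun s hs => absurd rfl hs, ?_, fun _ => rfl⟩
        rw [map_zero]
        ext t
        by_contra ht
        have h1 : w ∉ t := fun h => ht (by simp [lk, h])
        have h2 : z (insert w t) ≠ 0 := fun h => ht (by simp [lk, h1, h])
        exact hwW ((hz _ h2).2.1 (Finset.mem_insert_self _ _))
    -- Modulo a boundary, the cycle avoids `w`.
    have hg' : IsSetChain S.faces (W.erase w) (k + 2) g := fun s hs => by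
      obtain ⟨-, h2, h3⟩ := hg s hs
      exact ⟨(S.isRelLowerSet_faces hσ).2 (h2.trans Finset.inter_subset_right)
        (Finset.card_pos.1 (by omega)), h2.trans Finset.inter_subset_left, h3⟩
    have hy : IsSetChain S.faces (W.erase w) (k + 2) (del w z + g) :=
      ((hdel hz).mono (fun s hs _ _ => hs.1) subset_rfl).add hg'
    have hy0 : bd (del w z + g) = 0 := by
      rw [map_add, hd0, hgz, ZModModule.add_self]
    obtain ⟨g', hg'1, hg'2⟩ := hS.acyclic _ _ _ hk hkD hy hy0
    have hcone : IsSetChain S'.faces W (k + 2 + 1) (cone w g) := by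
      intro s hs
      have hwW : w ∈ W := by
        by_contra hwW
        simp [hgW hwW] at hs
      refine hg.cone (S' := S'.faces) hwW (Finset.inter_subset_left.trans (Finset.erase_subset _ _))
        (fun t _ ht hc hwt => ?_) s hs
      refine (hmem _).2 (Or.inr ⟨Finset.mem_insert_self _ _, ?_⟩)
      rw [Finset.erase_insert hwt]
      refine (ht.trans Finset.inter_subset_right).ssubset_of_ne ?_
      rintro rfl
      omega
    refine ⟨cone w g + g', hcone.add (hg'1.mono (fun s hs _ hc => ?_) (Finset.erase_subset _ _)),
      ?_⟩
    · refine (hmem s).2 (Or.inl ⟨hs, ?_⟩)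
      rintro rfl
      omega
    · rw [map_add, bd_cone, hgz, hg'2]
      linear_combination (exp := 1) del_add_cone_lk w z + ZModModule.add_self g

theorem IsStackedSphere.sphereLike {D : ℕ} (hD : 1 ≤ D) {S : PreAbstractSimplicialComplex V}
    (h : IsStackedSphere D S) : SphereLike D S.faces := by
  induction h with
  | boundary A hA => exact sphereLike_boundary hA
  | stack S _ σ hσ hcard w hw ih => exact sphereLike_stellarSubdivision hD ih hσ hcard hw

end Stacked

/-! ### Injectivity for induced subcomplexes -/

section Manifold

set_option linter.unusedSectionVars false

variable {V : Type} [Fintype V] [DecidableEq V] {K : AbstractSimplicialComplex V} {d : ℕ}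

theorem lk_zero (v : V) : lk v (0 : SetChain V) = 0 := by
  ext t; simp [lk]

theorem IsSetChain.eq_zero_of_card {S : Set (Finset V)} {W : Finset V} {k : ℕ} {c : SetChain V}
    (h : IsSetChain S W k c) (hS : ∀ s ∈ S, s.card ≠ k) : c = 0 := by
  ext s
  by_contra hs
  exact hS s (h s hs).1 (h s hs).2.2

/-- The part of a chain of `K[W ∪ {v}]` around `v` is a chain of the link of `v` inside `W`. -/
theorem IsSetChain.lk_link {W : Finset V} {v : V} {k : ℕ} {z : SetChain V}
    (hz : IsSetChain K.faces (insert v W) (k + 2) z) (hv : v ∉ W) :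
    IsSetChain (link K v).faces W (k + 1) (Walkup.lk v z) := by
  have h := hz.lk (v := v)
  rw [Finset.erase_insert hv] at h
  exact h.mono (fun s hs _ hc => ⟨Finset.card_pos.1 (by omega), hs.1, hs.2⟩) subset_rfl

theorem IsSetChain.del_insert {W : Finset V} {v : V} {k : ℕ} {z : SetChain V}
    (hz : IsSetChain K.faces (insert v W) k z) (hv : v ∉ W) :
    IsSetChain K.faces W k (Walkup.del v z) := by
  have h := hz.del (v := v)
  rw [Finset.erase_insert hv] at h
  exact h.mono (fun s hs _ _ => hs.1) subset_rfl

/-- In the middle dimensions `2, …, d - 2` all induced subcomplexes have vanishing homology, since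
attaching a vertex attaches a cone over a subcomplex of its link. -/
theorem exists_bd_eq_of_middle (hL : ∀ v, SphereLike (d - 1) (link K v).faces) (W : Finset V) :
    ∀ k z, 3 ≤ k → k + 1 ≤ d → IsSetChain K.faces W k z → bd z = 0 →
      ∃ g, IsSetChain K.faces W (k + 1) g ∧ bd g = z := by
  induction W using Finset.induction_on with
  | empty =>
    intro k z hk _ hz _
    obtain ⟨k, rfl⟩ := Nat.exists_eq_add_of_le' (show 1 ≤ k by omega)
    exact ⟨0, fun s hs => absurd rfl hs, by rw [hz.eq_zero_of_empty, map_zero]⟩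
  | insert v W hv ih =>
    intro k z hk hkd hz hz0
    obtain ⟨k, rfl⟩ := Nat.exists_eq_add_of_le' (show 2 ≤ k by omega)
    have hb : lk v (bd z) = 0 := by rw [hz0, lk_zero]
    obtain ⟨g, hg, hgz⟩ := (hL v).acyclic W (k + 1) (lk v z) (by omega) (by omega)
      (hz.lk_link hv) (by rw [← lk_bd, hb])
    have hgK : IsSetChain K.faces W (k + 2) g := hg.mono (fun s hs _ _ =>
      (K.isRelLowerSet_faces hs.2.2).2 (Finset.subset_insert _ _) hs.1) subset_rfl
    obtain ⟨g', hg', hgz'⟩ := ih (k + 2) (del v z + g) hk hkd ((hz.del_insert hv).add hgK)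
      (by rw [map_add, bd_del v z hb, hz0, zero_add, hgz, ZModModule.add_self])
    refine ⟨cone v g + g', IsSetChain.add ?_ (hg'.mono (fun s hs _ _ => hs)
      (Finset.subset_insert _ _)), ?_⟩
    · exact hg.cone (Finset.mem_insert_self _ _) (Finset.subset_insert _ _)
        fun s hs _ _ _ => hs.2.2
    · rw [map_add, bd_cone, hgz, hgz']
      linear_combination (exp := 1) del_add_cone_lk v z + ZModModule.add_self g

theorem lk_allFaces (hd : 1 ≤ d) (v : V) :
    lk v (allFaces K.faces (d + 1)) = allFaces (link K v).faces (d - 1 + 1) := by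
  ext t
  by_cases hv : v ∈ t
  · simp [lk, allFaces, hv, link]
  · simp only [lk, hv, if_false]
    refine allFaces_congr ?_
    rw [Finset.card_insert_of_notMem hv]
    constructor
    · rintro ⟨h1, h2⟩
      exact ⟨⟨Finset.card_pos.1 (by omega), hv, h1⟩, by omega⟩
    · rintro ⟨⟨h1, h2, h3⟩, h4⟩
      exact ⟨h3, by omega⟩

/-- The facets of `K` form a cycle, because those of each vertex link do. -/
theorem bd_allFaces_eq_zero (hd : 1 ≤ d) (hL : ∀ v, SphereLike (d - 1) (link K v).faces) :
    bd (allFaces K.faces (d + 1)) = 0 := by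
  ext t
  rcases t.eq_empty_or_nonempty with rfl | ⟨v, hv⟩
  · rw [bd_apply]
    refine Finset.sum_eq_zero fun u _ => ?_
    by_contra h
    have := (allFaces_ne_zero.1 h).2
    simp at this
    omega
  · have h := congrFun (lk_bd v (allFaces K.faces (d + 1))) (t.erase v)
    rw [lk_allFaces hd, (hL v).bd_allFaces] at h
    simpa [lk, Finset.insert_erase hv] using h

/-- Adding a vertex `v` to an induced subcomplex kills no homology: the part `f` around `v` of a
chain with boundary in `K[W]` is a cycle in the link of `v`, and such a cycle bounds in `K[W]`. -/
theorem exists_bd_eq_of_insert (hd : d = 2 ∨ 4 ≤ d)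
    (hL : ∀ v, SphereLike (d - 1) (link K v).faces) (hN : IsNeighborly 2 K) {W : Finset V} {v : V}
    (hv : v ∉ W) {k : ℕ} {c e : SetChain V} (hc : IsSetChain K.faces W (k + 1) c)
    (he : IsSetChain K.faces (insert v W) (k + 2) e) (hec : bd e = c) :
    ∃ e', IsSetChain K.faces W (k + 2) e' ∧ bd e' = c := by
  have hb : lk v (bd e) = 0 := by
    rw [hec]
    ext s
    simp only [lk, Pi.zero_apply, ite_eq_left_iff]
    intro _
    by_contra h
    exact hv ((hc _ h).2.1 (Finset.mem_insert_self _ _))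
  have hf := he.lk_link hv
  have hf0 : bd (lk v e) = 0 := by rw [← lk_bd, hb]
  have hfK : IsSetChain K.faces W (k + 1) (lk v e) := hf.mono (fun s hs _ _ =>
      (K.isRelLowerSet_faces hs.2.2).2 (Finset.subset_insert _ _) hs.1) subset_rfl
  suffices h : ∃ g, IsSetChain K.faces W (k + 2) g ∧ bd g = lk v e by
    obtain ⟨g, hg, hgf⟩ := h
    refine ⟨del v e + g, (he.del_insert hv).add hg, ?_⟩
    rw [map_add, bd_del v e hb, hgf, add_assoc, ZModModule.add_self, add_zero, hec]
  by_cases h0 : lk v e = 0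
  · exact ⟨0, fun s hs => absurd rfl hs, by rw [h0, map_zero]⟩
  rcases Nat.eq_zero_or_pos k with rfl | hk
  · -- An even set of vertices bounds, because all edges are present.
    obtain ⟨s, hs⟩ := Function.ne_iff.1 h0
    obtain ⟨-, hsW, hs1⟩ := hf s hs
    obtain ⟨x, rfl⟩ := Finset.card_eq_one.1 hs1
    refine ⟨cone x (lk v e), hfK.cone (hsW (Finset.mem_singleton_self x)) subset_rfl
      fun t _ _ ht hxt => hN _ (Finset.insert_nonempty _ _) ?_, eq_bd_cone hf0 x⟩
    rw [Finset.card_insert_of_notMem hxt]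
    omega
  by_cases hk1 : k + 3 ≤ d
  · obtain ⟨g, hg, hgf⟩ := (hL v).acyclic W (k + 1) _ (by omega) (by omega) hf hf0
    exact ⟨g, hg.mono (fun s hs _ _ =>
      (K.isRelLowerSet_faces hs.2.2).2 (Finset.subset_insert _ _) hs.1) subset_rfl, hgf⟩
  by_cases hk2 : k + 2 ≤ d
  · exact exists_bd_eq_of_middle hL W (k + 1) _ (by omega) (by omega) hfK hf0
  by_cases hk3 : k + 1 ≤ d
  · -- A nonzero top cycle of the link is its fundamental cycle, which bounds the facets off `v`.
    have hkd : k + 1 = d - 1 + 1 := by omega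
    rcases (hL v).top_cycle (lk v e) (hkd ▸ hf.mono (fun s hs _ _ => hs) (Finset.subset_univ _))
      hf0 with h | h
    · exact absurd h h0
    have hK := bd_allFaces_eq_zero (by omega) hL
    have hlk := lk_allFaces (K := K) (show 1 ≤ d by omega) v
    have hb' : lk v (bd (allFaces K.faces (d + 1))) = 0 := by rw [hK, lk_zero]
    -- Every vertex other than `v` lies in a facet of the link, hence in `W`.
    have huniv : insert v W = Finset.univ := by
      refine Finset.eq_univ_of_forall fun u => ?_
      by_cases huv : u = v
      · exact huv ▸ Finset.mem_insert_self _ _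
      have hu : {u} ∈ (link K v).faces := ⟨Finset.singleton_nonempty _, by simpa using Ne.symm huv,
        hN _ (Finset.insert_nonempty _ _) Finset.card_le_two⟩
      obtain ⟨t, ht, hut, htc⟩ := (hL v).exists_facet _ hu
      have h1 := allFaces_ne_zero.2 ⟨ht, htc⟩
      rw [← h] at h1
      exact Finset.mem_insert_of_mem ((hf t h1).2.1 (Finset.singleton_subset_iff.1 hut))
    refine ⟨del v (allFaces K.faces (d + 1)), IsSetChain.del_insert ?_ hv, ?_⟩
    · rw [huniv, show k + 2 = d + 1 by omega]
      exact isSetChain_allFaces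
    · rw [bd_del v _ hb', hK, zero_add, hlk, h]
  · refine absurd (hf.eq_zero_of_card fun s hs => ?_) h0
    have := (hL v).card_le s hs
    omega

/-- Inclusions of induced subcomplexes of `K` are injective in simplicial homology. -/
theorem exists_bd_eq_of_induced (hd : d = 2 ∨ 4 ≤ d) (hK : MemWalkupClass d K)
    (hN : IsNeighborly 2 K) (W : Finset V) {k : ℕ} {c e : SetChain V}
    (hc : IsSetChain K.faces W (k + 1) c) (he : IsSetChain K.faces Finset.univ (k + 2) e)
    (hec : bd e = c) : ∃ e', IsSetChain K.faces W (k + 2) e' ∧ bd e' = c := by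
  have hL : ∀ v, SphereLike (d - 1) (link K v).faces := fun v => (hK.2 v).sphereLike (by omega)
  suffices h : ∀ (U : Finset V) (e : SetChain V), Disjoint U W →
      IsSetChain K.faces (U ∪ W) (k + 2) e → bd e = c →
      ∃ e', IsSetChain K.faces W (k + 2) e' ∧ bd e' = c from
    h Wᶜ e disjoint_compl_left (by rwa [Finset.union_comm, Finset.union_compl]) hec
  intro U
  induction U using Finset.induction_on with
  | empty => intro e _ he hec; exact ⟨e, by simpa using he, hec⟩
  | insert v U hv ih =>
    intro e hU he hec
    rw [Finset.disjoint_insert_left] at hU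
    rw [Finset.insert_union] at he
    obtain ⟨e', he', hec'⟩ := exists_bd_eq_of_insert hd hL hN (by simp [hv, hU.1])
      (hc.mono (fun s hs _ _ => hs) Finset.subset_union_right) he hec
    exact ih e' hU.2 he' hec'

end Manifold

/-! ### Ordered chains -/

section Ordered

variable {X Y Z : Type}

/-- Ordered chains modulo two on a set `X`: formal sums of `n`-tuples of points of `X`. For `n = 0`
there is the empty tuple, so that the complex is augmented. -/
abbrev OrdChain (n : ℕ) (X : Type) : Type := (Fin n → X) →₀ ZMod 2

theorem map_mem_of_mem_supported {α M : Type*} [AddCommGroup M] [Module (ZMod 2) M]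
    {s : Set α} {N : Submodule (ZMod 2) M} (f : (α →₀ ZMod 2) →ₗ[ZMod 2] M)
    (h : ∀ a ∈ s, f (Finsupp.single a 1) ∈ N) {c : α →₀ ZMod 2}
    (hc : c ∈ Finsupp.supported (ZMod 2) (ZMod 2) s) : f c ∈ N := by
  rw [Finsupp.supported_eq_span_single] at hc
  refine Submodule.span_induction (p := fun c _ => f c ∈ N) ?_ ?_ ?_ ?_ hc
  · rintro _ ⟨a, ha, rfl⟩
    exact h a ha
  · rw [map_zero]; exact N.zero_mem
  · intro x y _ _ hx hy
    rw [map_add]; exact N.add_mem hx hy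
  · intro a x _ hx
    rw [map_smul]; exact N.smul_mem a hx

theorem eq_of_mem_supported {α M : Type*} [AddCommGroup M] [Module (ZMod 2) M]
    {s : Set α} (f g : (α →₀ ZMod 2) →ₗ[ZMod 2] M)
    (h : ∀ a ∈ s, f (Finsupp.single a 1) = g (Finsupp.single a 1)) {c : α →₀ ZMod 2}
    (hc : c ∈ Finsupp.supported (ZMod 2) (ZMod 2) s) : f c = g c := by
  have := map_mem_of_mem_supported (N := ⊥) (f - g) (fun a ha => by simp [h a ha]) hc
  simpa [sub_eq_zero] using this

theorem single_mem_supported {α : Type*} {s : Set α} {a : α} (h : a ∈ s) :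
    Finsupp.single a (1 : ZMod 2) ∈ Finsupp.supported (ZMod 2) (ZMod 2) s :=
  Finsupp.single_mem_supported _ _ h

/-- The (augmented) boundary of ordered chains modulo two. -/
noncomputable def obd (n : ℕ) : OrdChain (n + 1) X →ₗ[ZMod 2] OrdChain n X :=
  Finsupp.linearCombination (ZMod 2) fun p =>
    ∑ i : Fin (n + 1), Finsupp.single (p ∘ i.succAbove) 1

theorem obd_single (n : ℕ) (p : Fin (n + 1) → X) :
    obd n (Finsupp.single p 1) = ∑ i : Fin (n + 1), Finsupp.single (p ∘ i.succAbove) 1 := by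
  simp [obd]

/-- The cone with apex `x`. -/
noncomputable def ocone {n : ℕ} (x : X) : OrdChain n X →ₗ[ZMod 2] OrdChain (n + 1) X :=
  Finsupp.lmapDomain _ _ fun p => Fin.cons x p

theorem ocone_single {n : ℕ} (x : X) (p : Fin n → X) :
    ocone x (Finsupp.single p 1) = Finsupp.single (Fin.cons x p : Fin (n + 1) → X) 1 := by
  simp [ocone]

/-- The map of ordered chains induced by a map of vertices. -/
noncomputable def omap {n : ℕ} (f : X → Y) : OrdChain n X →ₗ[ZMod 2] OrdChain n Y :=
  Finsupp.lmapDomain _ _ fun p => f ∘ p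

theorem omap_single {n : ℕ} (f : X → Y) (p : Fin n → X) :
    omap f (Finsupp.single p 1) = Finsupp.single (f ∘ p) 1 := by
  simp [omap]

theorem omap_obd {n : ℕ} (f : X → Y) (c : OrdChain (n + 1) X) :
    omap f (obd n c) = obd n (omap f c) := by
  refine LinearMap.congr_fun (f := (omap f).comp (obd n)) (g := (obd n).comp (omap f)) ?_ c
  refine Finsupp.lhom_ext' fun p => LinearMap.ext_ring ?_
  simp only [LinearMap.comp_apply, Finsupp.lsingle_apply, obd_single, omap_single, map_sum]
  rfl

theorem omap_ocone {n : ℕ} (f : X → Y) (x : X) (c : OrdChain n X) :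
    omap f (ocone x c) = ocone (f x) (omap f c) := by
  refine LinearMap.congr_fun (f := (omap f).comp (ocone x)) (g := (ocone (f x)).comp (omap f)) ?_ c
  refine Finsupp.lhom_ext' fun p => LinearMap.ext_ring ?_
  simp only [LinearMap.comp_apply, Finsupp.lsingle_apply, ocone_single, omap_single]
  congr 1
  exact Fin.comp_cons _ _ _

theorem obd_ocone_zero (x : X) (c : OrdChain 0 X) : obd 0 (ocone x c) = c := by
  refine LinearMap.congr_fun (f := (obd 0).comp (ocone x)) (g := LinearMap.id) ?_ c
  refine Finsupp.lhom_ext' fun p => LinearMap.ext_ring ?_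
  simp only [LinearMap.comp_apply, Finsupp.lsingle_apply, ocone_single, obd_single,
    LinearMap.id_apply]
  refine (Fin.sum_univ_one _).trans ?_
  congr 1

theorem obd_ocone {n : ℕ} (x : X) (c : OrdChain (n + 1) X) :
    obd (n + 1) (ocone x c) = c + ocone x (obd n c) := by
  refine LinearMap.congr_fun (f := (obd (n + 1)).comp (ocone x))
    (g := LinearMap.id + (ocone x).comp (obd n)) ?_ c
  refine Finsupp.lhom_ext' fun p => LinearMap.ext_ring ?_
  simp only [LinearMap.comp_apply, LinearMap.add_apply, Finsupp.lsingle_apply, ocone_single,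
    obd_single, LinearMap.id_apply, map_sum]
  rw [Fin.sum_univ_succ]
  congr 1
  refine Finset.sum_congr rfl fun i _ => ?_
  congr 1
  ext j
  refine Fin.cases ?_ (fun j => ?_) j
  · simp
  · simp

theorem obd_obd {n : ℕ} (c : OrdChain (n + 2) X) : obd n (obd (n + 1) c) = 0 := by
  induction n with
  | zero =>
    refine LinearMap.congr_fun (f := (obd 0).comp (obd 1)) (g := 0) ?_ c
    refine Finsupp.lhom_ext' fun p => LinearMap.ext_ring ?_
    rw [← Fin.cons_self_tail p]
    simp only [LinearMap.comp_apply, Finsupp.lsingle_apply, LinearMap.zero_apply]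
    rw [← ocone_single, obd_ocone, map_add, obd_ocone_zero, ZModModule.add_self]
  | succ n ih =>
    refine LinearMap.congr_fun (f := (obd (n + 1)).comp (obd (n + 2))) (g := 0) ?_ c
    refine Finsupp.lhom_ext' fun p => LinearMap.ext_ring ?_
    rw [← Fin.cons_self_tail p]
    simp only [LinearMap.comp_apply, Finsupp.lsingle_apply, LinearMap.zero_apply]
    rw [← ocone_single, obd_ocone, map_add, obd_ocone, ih, map_zero, add_zero,
      ZModModule.add_self]

/-- Ordered chains all of whose simplices have their vertices in `P`. -/
noncomputable abbrev ordIn (n : ℕ) (P : Set X) : Submodule (ZMod 2) (OrdChain n X) :=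
  Finsupp.supported _ _ {p | ∀ i, p i ∈ P}

theorem obd_mem {n : ℕ} {P : Set X} {c : OrdChain (n + 1) X} (hc : c ∈ ordIn (n + 1) P) :
    obd n c ∈ ordIn n P := by
  refine map_mem_of_mem_supported _ (fun p hp => ?_) hc
  rw [obd_single]
  exact Submodule.sum_mem _ fun i _ => single_mem_supported fun j => hp _

theorem ocone_mem {n : ℕ} {P : Set X} {x : X} (hx : x ∈ P) {c : OrdChain n X}
    (hc : c ∈ ordIn n P) : ocone x c ∈ ordIn (n + 1) P := by
  refine map_mem_of_mem_supported _ (fun p hp => ?_) hc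
  rw [ocone_single]
  exact single_mem_supported fun j => Fin.cases (by simpa using hx) (fun j => by simpa using hp j) j

/-- The homotopy obtained by coning: if `r` is a chain map, then
`A p = g p₀ · (r p + A (∂ p))` satisfies `∂ A + A ∂ = r`. -/
noncomputable def coneHomotopy (r : ∀ n, OrdChain n X →ₗ[ZMod 2] OrdChain n Y) (g : X → Y) :
    ∀ n, OrdChain n X →ₗ[ZMod 2] OrdChain (n + 1) Y
  | 0 => 0
  | n + 1 => Finsupp.linearCombination (ZMod 2) fun p =>
      ocone (g (p 0)) (r (n + 1) (Finsupp.single p 1) +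
        coneHomotopy r g n (obd n (Finsupp.single p 1)))

theorem coneHomotopy_single (r : ∀ n, OrdChain n X →ₗ[ZMod 2] OrdChain n Y) (g : X → Y) (n : ℕ)
    (p : Fin (n + 1) → X) :
    coneHomotopy r g (n + 1) (Finsupp.single p 1) =
      ocone (g (p 0)) (r (n + 1) (Finsupp.single p 1) +
        coneHomotopy r g n (obd n (Finsupp.single p 1))) := by
  simp [coneHomotopy]

theorem obd_coneHomotopy (r : ∀ n, OrdChain n X →ₗ[ZMod 2] OrdChain n Y) (g : X → Y)
    (hr0 : r 0 = 0) (hr : ∀ n c, obd n (r (n + 1) c) = r n (obd n c)) (n : ℕ)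
    (c : OrdChain (n + 1) X) :
    obd (n + 1) (coneHomotopy r g (n + 1) c) + coneHomotopy r g n (obd n c) = r (n + 1) c := by
  induction n with
  | zero =>
    refine LinearMap.congr_fun (f := (obd 1).comp (coneHomotopy r g 1) +
      (coneHomotopy r g 0).comp (obd 0)) (g := r 1) ?_ c
    refine Finsupp.lhom_ext' fun p => LinearMap.ext_ring ?_
    simp only [LinearMap.comp_apply, LinearMap.add_apply, Finsupp.lsingle_apply,
      coneHomotopy_single, obd_ocone, map_add, hr, hr0]
    simp [coneHomotopy]
  | succ n ih =>
    refine LinearMap.congr_fun (f := (obd (n + 2)).comp (coneHomotopy r g (n + 2)) +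
      (coneHomotopy r g (n + 1)).comp (obd (n + 1))) (g := r (n + 2)) ?_ c
    refine Finsupp.lhom_ext' fun p => LinearMap.ext_ring ?_
    have h := ih (obd (n + 1) (Finsupp.single p 1))
    rw [obd_obd, map_zero, add_zero] at h
    simp only [LinearMap.comp_apply, LinearMap.add_apply, Finsupp.lsingle_apply,
      coneHomotopy_single, obd_ocone, map_add, hr, h]
    linear_combination (norm := module)
      ZModModule.add_self (ocone (g (p 0)) (r (n + 1) (obd (n + 1) (Finsupp.single p 1)))) +
      ZModModule.add_self (coneHomotopy r g (n + 1) (obd (n + 1) (Finsupp.single p 1)))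

theorem coneHomotopy_mem {r : ∀ n, OrdChain n X →ₗ[ZMod 2] OrdChain n Y} {g : X → Y} {P : Set X}
    {Q : Set Y} (hr : ∀ n, ∀ c ∈ ordIn n P, r n c ∈ ordIn n Q) (hg : ∀ x ∈ P, g x ∈ Q) (n : ℕ)
    {c : OrdChain n X} (hc : c ∈ ordIn n P) : coneHomotopy r g n c ∈ ordIn (n + 1) Q := by
  induction n with
  | zero => exact Submodule.zero_mem _
  | succ n ih =>
    refine map_mem_of_mem_supported _ (fun p hp => ?_) hc
    have hp' := single_mem_supported hp
    rw [coneHomotopy_single]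
    exact ocone_mem (hg _ (hp 0)) (Submodule.add_mem _ (hr _ _ hp') (ih (obd_mem hp')))

theorem omap_coneHomotopy {X' Y' : Type} {r : ∀ n, OrdChain n X →ₗ[ZMod 2] OrdChain n Y}
    {g : X → Y} {r' : ∀ n, OrdChain n X' →ₗ[ZMod 2] OrdChain n Y'} {g' : X' → Y'}
    (f : X → X') (h : Y → Y') (hr : ∀ n c, omap h (r n c) = r' n (omap f c))
    (hg : ∀ x, h (g x) = g' (f x)) (n : ℕ) (c : OrdChain n X) :
    omap h (coneHomotopy r g n c) = coneHomotopy r' g' n (omap f c) := by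
  induction n with
  | zero => simp [coneHomotopy]
  | succ n ih =>
    refine LinearMap.congr_fun (f := (omap h).comp (coneHomotopy r g (n + 1)))
      (g := (coneHomotopy r' g' (n + 1)).comp (omap f)) ?_ c
    refine Finsupp.lhom_ext' fun p => LinearMap.ext_ring ?_
    simp only [LinearMap.comp_apply, Finsupp.lsingle_apply, coneHomotopy_single, omap_single,
      omap_ocone, map_add, hr, ih, omap_obd, hg, Function.comp_apply]

end Ordered

/-! ### Ordered and unordered simplicial chains -/

section Compare

set_option linter.unusedSectionVars false

variable {V : Type} [Fintype V] [DecidableEq V]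

/-- Forgetting the order of the vertices; degenerate tuples are sent to zero. -/
noncomputable def forgetOrder (n : ℕ) : OrdChain n V →ₗ[ZMod 2] SetChain V :=
  Finsupp.linearCombination (ZMod 2) fun p =>
    if (Finset.univ.image p).card = n then Pi.single (Finset.univ.image p) 1 else 0

theorem forgetOrder_single (n : ℕ) (p : Fin n → V) : forgetOrder n (Finsupp.single p 1) =
    if (Finset.univ.image p).card = n then Pi.single (Finset.univ.image p) 1 else 0 := by
  simp [forgetOrder]

theorem card_image_eq_iff {n : ℕ} (p : Fin n → V) :
    (Finset.univ.image p).card = n ↔ Function.Injective p := by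
  have h := Finset.card_image_iff (s := Finset.univ) (f := p)
  rwa [Finset.card_univ, Fintype.card_fin, Finset.coe_univ, Set.injOn_univ] at h

theorem bd_single (A : Finset V) :
    bd (Pi.single A 1) = ∑ v ∈ A, (Pi.single (A.erase v) 1 : SetChain V) := by
  ext t
  simp only [bd_apply, Finset.sum_apply, Pi.single_apply]
  rw [← Finset.sum_filter, ← Finset.sum_filter]
  refine Finset.sum_congr ?_ fun _ _ => rfl
  ext v
  simp only [Finset.mem_filter, Finset.mem_compl]
  constructor
  · rintro ⟨h, rfl⟩
    exact ⟨Finset.mem_insert_self _ _, (Finset.erase_insert h).symm⟩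
  · rintro ⟨h, rfl⟩
    exact ⟨Finset.notMem_erase _ _, Finset.insert_erase h⟩

/-- Forgetting the order is a chain map. -/
theorem forgetOrder_obd (n : ℕ) (c : OrdChain (n + 1) V) :
    forgetOrder n (obd n c) = bd (forgetOrder (n + 1) c) := by
  refine LinearMap.congr_fun (f := (forgetOrder n).comp (obd n))
    (g := bd.comp (forgetOrder (n + 1))) ?_ c
  refine Finsupp.lhom_ext' fun p => LinearMap.ext_ring ?_
  simp only [LinearMap.comp_apply, Finsupp.lsingle_apply, obd_single, map_sum, forgetOrder_single]
  by_cases hp : Function.Injective p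
  · rw [if_pos ((card_image_eq_iff p).2 hp), bd_single, Finset.sum_image fun _ _ _ _ h => hp h]
    refine Finset.sum_congr rfl fun i _ => ?_
    rw [if_pos ((card_image_eq_iff _).2 (hp.comp Fin.succAbove_right_injective)),
      ← Finset.image_image, Fin.image_succAbove_univ, Finset.compl_singleton,
      Finset.image_erase hp]
  · -- Only the two faces omitting one of two equal vertices survive, and they agree.
    rw [if_neg ((card_image_eq_iff p).not.2 hp), map_zero]
    obtain ⟨a, b, hab, hne⟩ : ∃ a b, p a = p b ∧ a ≠ b := by
      simpa [Function.Injective] using hp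
    have key : ∀ a b, p a = p b → a ≠ b →
        Finset.univ.image (p ∘ a.succAbove) = Finset.univ.image p := by
      intro a b hab hne
      refine Finset.Subset.antisymm (fun x hx => ?_) fun x hx => ?_
      · obtain ⟨i, -, rfl⟩ := Finset.mem_image.1 hx
        exact Finset.mem_image_of_mem _ (Finset.mem_univ _)
      · obtain ⟨i, -, rfl⟩ := Finset.mem_image.1 hx
        by_cases hi : i = a
        · obtain ⟨j, hj⟩ := Fin.exists_succAbove_eq hne.symm
          exact Finset.mem_image.2 ⟨j, Finset.mem_univ _, by simp [hj, hi, hab]⟩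
        · obtain ⟨j, hj⟩ := Fin.exists_succAbove_eq hi
          exact Finset.mem_image.2 ⟨j, Finset.mem_univ _, by simp [hj]⟩
    rw [Finset.sum_eq_add a b hne _ (by simp) (by simp), key a b hab hne, key b a hab.symm hne.symm,
      ZModModule.add_self]
    intro i _ hi
    rw [if_neg]
    rw [card_image_eq_iff]
    intro hinj
    obtain ⟨j, hj⟩ := Fin.exists_succAbove_eq hi.1.symm
    obtain ⟨j', hj'⟩ := Fin.exists_succAbove_eq hi.2.symm
    have : j = j' := hinj (by simp [hj, hj', hab])
    exact hne (by rw [← hj, ← hj', this])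

/-- Choosing orders: a set of vertices is sent to a chain of its orderings, the cone from one
of its elements over the chain of its boundary. -/
noncomputable def chooseOrder : ∀ n, SetChain V →ₗ[ZMod 2] OrdChain n V
  | 0 => (Pi.basisFun (ZMod 2) (Finset V)).constr (ZMod 2) fun s =>
      if s = ∅ then Finsupp.single Fin.elim0 1 else 0
  | n + 1 => (Pi.basisFun (ZMod 2) (Finset V)).constr (ZMod 2) fun s =>
      if h : s.Nonempty then ocone h.choose (chooseOrder n (bd (Pi.single s 1))) else 0

theorem chooseOrder_zero_single (s : Finset V) : chooseOrder 0 (Pi.single s 1) =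
    if s = ∅ then Finsupp.single Fin.elim0 1 else 0 := by
  rw [chooseOrder, ← Pi.basisFun_apply (ZMod 2) (Finset V) s, Module.Basis.constr_basis]

theorem chooseOrder_succ_single (n : ℕ) (s : Finset V) : chooseOrder (n + 1) (Pi.single s 1) =
    if h : s.Nonempty then ocone h.choose (chooseOrder n (bd (Pi.single s 1))) else 0 := by
  rw [← Pi.basisFun_apply (ZMod 2) (Finset V) s, chooseOrder, Module.Basis.constr_basis,
    Pi.basisFun_apply]

theorem setChain_eq_sum (c : SetChain V) : c = ∑ s, c s • (Pi.single s 1 : SetChain V) := by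
  ext t
  simp [Finset.sum_apply, Pi.single_apply]

/-- Choosing orders is a chain map. -/
theorem obd_chooseOrder (n : ℕ) (c : SetChain V) :
    obd n (chooseOrder (n + 1) c) = chooseOrder n (bd c) := by
  induction n generalizing c with
  | zero =>
    rw [setChain_eq_sum c]
    simp only [map_sum, map_smul]
    refine Finset.sum_congr rfl fun s _ => congrArg _ ?_
    rw [chooseOrder_succ_single]
    split_ifs with h
    · rw [obd_ocone_zero]
    · rw [Finset.not_nonempty_iff_eq_empty.1 h, bd_single, Finset.sum_empty, map_zero, map_zero]
  | succ n ih =>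
    rw [setChain_eq_sum c]
    simp only [map_sum, map_smul]
    refine Finset.sum_congr rfl fun s _ => congrArg _ ?_
    rw [chooseOrder_succ_single]
    split_ifs with h
    · rw [obd_ocone, ih, bd_bd, map_zero, map_zero, add_zero]
    · rw [Finset.not_nonempty_iff_eq_empty.1 h, bd_single, Finset.sum_empty, map_zero, map_zero]

theorem chooseOrder_mem_single (n : ℕ) (s : Finset V) :
    chooseOrder n (Pi.single s 1) ∈ ordIn n (s : Set V) := by
  induction n generalizing s with
  | zero =>
    rw [chooseOrder_zero_single]
    split_ifs
    · exact single_mem_supported fun i => i.elim0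
    · exact Submodule.zero_mem _
  | succ n ih =>
    rw [chooseOrder_succ_single]
    split_ifs with h
    · refine ocone_mem h.choose_spec ?_
      rw [bd_single, map_sum]
      refine Submodule.sum_mem _ fun v _ => ?_
      refine Finsupp.supported_mono (fun p hp i => ?_) (ih (s.erase v))
      exact Finset.erase_subset _ _ (hp i)
    · exact Submodule.zero_mem _

/-- Ordered chains of the induced subcomplex `K[W]`. -/
noncomputable abbrev ordFaces (K : AbstractSimplicialComplex V) (W : Finset V) (n : ℕ) :
    Submodule (ZMod 2) (OrdChain n V) :=
  Finsupp.supported _ _ {p | (∀ i, p i ∈ W) ∧ Finset.univ.image p ∈ K.faces}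

theorem ordIn_le_ordFaces {K : AbstractSimplicialComplex V} {W s : Finset V} {n : ℕ}
    (hsW : s ⊆ W) (hs : s ∈ K.faces) : ordIn (n + 1) (s : Set V) ≤ ordFaces K W (n + 1) := by
  refine Finsupp.supported_mono fun p hp => ⟨fun i => hsW (hp i), ?_⟩
  refine (K.isRelLowerSet_faces hs).2 ?_ (Finset.univ_nonempty.image _)
  intro x hx
  obtain ⟨i, -, rfl⟩ := Finset.mem_image.1 hx
  exact hp i

theorem chooseOrder_mem {K : AbstractSimplicialComplex V} {W : Finset V} {n k : ℕ}
    {c : SetChain V} (hc : IsSetChain K.faces W k c) :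
    chooseOrder (n + 1) c ∈ ordFaces K W (n + 1) := by
  rw [setChain_eq_sum c, map_sum]
  refine Submodule.sum_mem _ fun s _ => ?_
  rw [map_smul]
  by_cases h : c s = 0
  · rw [h, zero_smul]
    exact Submodule.zero_mem _
  · exact Submodule.smul_mem _ _ (ordIn_le_ordFaces (hc s h).2.1 (hc s h).1
      (chooseOrder_mem_single _ _))

theorem forgetOrder_isSetChain {K : AbstractSimplicialComplex V} {W : Finset V} {n : ℕ}
    {c : OrdChain n V} (hc : c ∈ ordFaces K W n) :
    IsSetChain K.faces W n (forgetOrder n c) := by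
  let N : Submodule (ZMod 2) (SetChain V) :=
    { carrier := {c | IsSetChain K.faces W n c}
      add_mem' := fun h h' => h.add h'
      zero_mem' := fun s hs => absurd rfl hs
      smul_mem' := fun a c h s hs => h s fun h0 => hs (by simp [h0]) }
  refine map_mem_of_mem_supported (N := N) _ (fun p hp => ?_) hc
  rw [forgetOrder_single]
  split_ifs with h
  · intro s hs
    have hs' : s = Finset.univ.image p := by
      by_contra h'
      exact hs (Pi.single_eq_of_ne h' _)
    subst hs'
    refine ⟨hp.2, fun x hx => ?_, h⟩
    obtain ⟨i, -, rfl⟩ := Finset.mem_image.1 hx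
    exact hp.1 i
  · exact N.zero_mem

/-- The difference between an ordered chain and its reordering. It vanishes on the empty simplex and
respects supports, so that `coneHomotopy` makes it null-homotopic. -/
noncomputable def reorder (n : ℕ) : OrdChain n V →ₗ[ZMod 2] OrdChain n V :=
  LinearMap.id + (chooseOrder n).comp (forgetOrder n)

theorem reorder_mem {n : ℕ} {P : Set V} {c : OrdChain n V} (hc : c ∈ ordIn n P) :
    reorder n c ∈ ordIn n P := by
  refine Submodule.add_mem _ hc (map_mem_of_mem_supported
    ((chooseOrder n).comp (forgetOrder n)) (fun p hp => ?_) hc)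
  rw [LinearMap.comp_apply, forgetOrder_single]
  split_ifs
  · refine Finsupp.supported_mono (fun q hq i => ?_) (chooseOrder_mem_single _ _)
    obtain ⟨j, -, hj⟩ := Finset.mem_image.1 (hq i)
    exact hj ▸ hp j
  · rw [map_zero]; exact Submodule.zero_mem _

theorem reorder_zero : reorder (V := V) 0 = 0 := by
  refine Finsupp.lhom_ext' fun p => LinearMap.ext_ring ?_
  have hp : p = Fin.elim0 := Subsingleton.elim _ _
  simp [reorder, forgetOrder_single, chooseOrder_zero_single, hp, ZModModule.add_self]

theorem obd_reorder (n : ℕ) (c : OrdChain (n + 1) V) :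
    obd n (reorder (n + 1) c) = reorder n (obd n c) := by
  simp [reorder, obd_chooseOrder, forgetOrder_obd]

/-- Injectivity in simplicial homology computed by ordered chains: ordered and unordered chains are
compared by the acyclic carrier homotopy. -/
theorem exists_obd_eq_of_induced {d : ℕ} {K : AbstractSimplicialComplex V}
    (hd : d = 2 ∨ 4 ≤ d) (hK : MemWalkupClass d K) (hN : IsNeighborly 2 K) (W : Finset V) {k : ℕ}
    {c : OrdChain (k + 1) V} {e : OrdChain (k + 2) V} (hc : c ∈ ordFaces K W (k + 1))
    (he : e ∈ ordFaces K Finset.univ (k + 2)) (hec : obd (k + 1) e = c) :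
    ∃ e' ∈ ordFaces K W (k + 2), obd (k + 1) e' = c := by
  obtain ⟨f, hf, hfc⟩ := exists_bd_eq_of_induced hd hK hN W (forgetOrder_isSetChain hc)
    (forgetOrder_isSetChain he) (by rw [← forgetOrder_obd, hec])
  refine ⟨chooseOrder (k + 2) f + coneHomotopy reorder id (k + 1) c,
    Submodule.add_mem _ (chooseOrder_mem hf) ?_, ?_⟩
  · refine map_mem_of_mem_supported _ (fun p hp => ?_) hc
    refine ordIn_le_ordFaces (s := Finset.univ.image p) (fun x hx => ?_) hp.2
      (coneHomotopy_mem (fun _ _ => reorder_mem) (fun _ hx => hx) _ (single_mem_supported ?_))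
    · obtain ⟨i, -, rfl⟩ := Finset.mem_image.1 hx
      exact hp.1 i
    · intro i
      exact Finset.mem_image_of_mem _ (Finset.mem_univ _)
  · have h := obd_coneHomotopy reorder id reorder_zero obd_reorder k c
    rw [← hec, obd_obd, map_zero, add_zero, hec] at h
    rw [map_add, obd_chooseOrder, hfc, h]
    simp only [reorder, LinearMap.add_apply, LinearMap.id_apply, LinearMap.comp_apply]
    linear_combination (norm := module)
      ZModModule.add_self (chooseOrder (k + 1) (forgetOrder (k + 1) c))

end Compare

/-! ### Singular chains of a vector space -/

section Singular

set_option linter.unusedSectionVars false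

variable {E F : Type} [NormedAddCommGroup E] [NormedSpace ℝ E] [AddCommGroup F] [Module ℝ F]

/-- Singular chains modulo two in `E`, spanned by all functions on a standard simplex with `n`
vertices; continuity and the image are controlled by `singIn`. -/
abbrev SingChain (n : ℕ) (E : Type) : Type := (stdSimplex ℝ (Fin n) → E) →₀ ZMod 2

/-- Singular chains of the subspace `A`: those formed by continuous simplices with image in `A`. -/
noncomputable abbrev singIn {E : Type} [TopologicalSpace E] (n : ℕ) (A : Set E) :
    Submodule (ZMod 2) (SingChain n E) :=
  Finsupp.supported _ _ {σ | Continuous σ ∧ ∀ x, σ x ∈ A}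

/-- The singular boundary modulo two. Simplices are indexed by their number of vertices, and `sbd 0`
is the augmentation. -/
noncomputable def sbd {E : Type} (n : ℕ) : SingChain (n + 1) E →ₗ[ZMod 2] SingChain n E :=
  Finsupp.linearCombination (ZMod 2) fun σ =>
    ∑ i : Fin (n + 1), Finsupp.single (σ ∘ stdSimplex.map i.succAbove) 1

theorem sbd_single {E : Type} (n : ℕ) (σ : stdSimplex ℝ (Fin (n + 1)) → E) :
    sbd n (Finsupp.single σ 1) = ∑ i : Fin (n + 1), Finsupp.single (σ ∘ stdSimplex.map i.succAbove) 1 := by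
  simp [sbd]

theorem linearCombination_map {m n : ℕ} (q : Fin m → F) (f : Fin n → Fin m)
    (x : stdSimplex ℝ (Fin n)) :
    Fintype.linearCombination ℝ q (stdSimplex.map f x : stdSimplex ℝ (Fin m)) =
      Fintype.linearCombination ℝ (q ∘ f) x := by
  simp only [Fintype.linearCombination_apply, stdSimplex.map_coe, FunOnFinite.linearMap_apply_apply,
    Finset.sum_smul, Function.comp_apply]
  rw [← Finset.sum_fiberwise Finset.univ f]
  refine Finset.sum_congr rfl fun j _ => Finset.sum_congr ?_ fun i hi => ?_
  · ext; simp
  · simp only [Finset.mem_filter] at hi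
    rw [hi.2]

/-- The singular chain given by affine simplices with prescribed vertices, followed by `G`. -/
noncomputable def push {n : ℕ} (G : F → E) : OrdChain n F →ₗ[ZMod 2] SingChain n E :=
  Finsupp.lmapDomain _ _ fun q x => G (Fintype.linearCombination ℝ q x)

theorem push_single {n : ℕ} (G : F → E) (q : Fin n → F) : push G (Finsupp.single q 1) =
    Finsupp.single (fun x : stdSimplex ℝ (Fin n) => G (Fintype.linearCombination ℝ q x)) 1 := by
  simp [push]

theorem sbd_push {n : ℕ} (G : F → E) (c : OrdChain (n + 1) F) :
    sbd n (push G c) = push G (obd n c) := by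
  refine LinearMap.congr_fun (f := (sbd n).comp (push G)) (g := (push G).comp (obd n)) ?_ c
  refine Finsupp.lhom_ext' fun p => LinearMap.ext_ring ?_
  simp only [LinearMap.comp_apply, Finsupp.lsingle_apply, push_single, sbd_single, obd_single,
    map_sum]
  refine Finset.sum_congr rfl fun i _ => ?_
  congr 1
  ext x
  simp only [Function.comp_apply, linearCombination_map]

theorem push_omap {n : ℕ} {F' : Type} [AddCommGroup F'] [Module ℝ F'] (G : F' → E)
    (L : F →ₗ[ℝ] F') (c : OrdChain n F) : push G (omap L c) = push (G ∘ L) c := by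
  refine LinearMap.congr_fun (f := (push G).comp (omap L)) (g := push (G ∘ L)) ?_ c
  refine Finsupp.lhom_ext' fun p => LinearMap.ext_ring ?_
  simp only [LinearMap.comp_apply, Finsupp.lsingle_apply, push_single, omap_single]
  congr 1
  ext x
  simp [Fintype.linearCombination_apply]

theorem linearCombination_mem {n : ℕ} {D : Set F} (hD : Convex ℝ D) {q : Fin n → F}
    (hq : ∀ i, q i ∈ D) (x : stdSimplex ℝ (Fin n)) : Fintype.linearCombination ℝ q x ∈ D := by
  rw [Fintype.linearCombination_apply]
  exact hD.sum_mem (fun i _ => x.2.1 i) x.2.2 fun i _ => hq i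

theorem push_congr {n : ℕ} {D : Set F} (hD : Convex ℝ D) {G G' : F → E}
    (h : ∀ y ∈ D, G y = G' y) {c : OrdChain n F} (hc : c ∈ ordIn n D) : push G c = push G' c := by
  refine eq_of_mem_supported _ _ (fun q hq => ?_) hc
  rw [push_single, push_single]
  congr 1
  ext x
  exact h _ (linearCombination_mem hD hq x)

theorem push_mem {n : ℕ} {F : Type} [NormedAddCommGroup F] [NormedSpace ℝ F] {D : Set F}
    (hD : Convex ℝ D) {G : F → E} (hG : ContinuousOn G D) {A : Set E} (hA : ∀ y ∈ D, G y ∈ A)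
    {c : OrdChain n F} (hc : c ∈ ordIn n D) : push G c ∈ singIn n A := by
  refine map_mem_of_mem_supported _ (fun q hq => ?_) hc
  rw [push_single]
  refine single_mem_supported ⟨?_, fun x => hA _ (linearCombination_mem hD hq x)⟩
  refine hG.comp_continuous ?_ fun x => linearCombination_mem hD hq x
  simp only [Fintype.linearCombination_apply]
  exact continuous_finsetSum _ fun i _ =>
    ((continuous_apply i).comp continuous_subtype_val).smul continuous_const

/-- The vertices of the standard simplex. -/
def stdVertex (n : ℕ) : Fin n → Fin n → ℝ := fun i => Pi.single i 1

theorem linearCombination_stdVertex {n : ℕ} (x : Fin n → ℝ) :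
    Fintype.linearCombination ℝ (stdVertex n) x = x := by
  ext j
  simp [Fintype.linearCombination_apply, stdVertex, Finset.sum_apply, Pi.single_apply]

theorem linearCombination_single {n : ℕ} (p : Fin n → F) (i : Fin n) :
    Fintype.linearCombination ℝ p (stdVertex n i) = p i := by
  simp [stdVertex]

theorem single_eq_omap {n : ℕ} (p : Fin n → F) : Finsupp.single p (1 : ZMod 2) =
    omap (Fintype.linearCombination ℝ p) (Finsupp.single (stdVertex n) 1) := by
  rw [omap_single]
  congr 1
  ext i
  exact (linearCombination_single p i).symm

theorem stdVertex_mem (n : ℕ) : Finsupp.single (stdVertex n) (1 : ZMod 2) ∈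
    ordIn n (stdSimplex ℝ (Fin n)) :=
  single_mem_supported fun i => single_mem_stdSimplex ℝ i

/-- The extension by zero of a singular simplex to the ambient space of the standard simplex. -/
noncomputable def extend {n : ℕ} (σ : stdSimplex ℝ (Fin n) → E) : (Fin n → ℝ) → E :=
  Function.extend Subtype.val σ 0

theorem extend_apply {n : ℕ} (σ : stdSimplex ℝ (Fin n) → E) (x : stdSimplex ℝ (Fin n)) :
    extend σ x = σ x :=
  Subtype.val_injective.extend_apply _ _ _

theorem extend_of_mem {n : ℕ} (σ : stdSimplex ℝ (Fin n) → E) {y : Fin n → ℝ}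
    (hy : y ∈ stdSimplex ℝ (Fin n)) : extend σ y = σ ⟨y, hy⟩ :=
  extend_apply σ ⟨y, hy⟩

theorem continuousOn_extend {n : ℕ} {σ : stdSimplex ℝ (Fin n) → E} (hσ : Continuous σ) :
    ContinuousOn (extend σ) (stdSimplex ℝ (Fin n)) := by
  rw [continuousOn_iff_continuous_domRestrict]
  convert hσ using 1
  ext x
  exact extend_apply σ x

theorem push_extend_stdVertex {n : ℕ} (σ : stdSimplex ℝ (Fin n) → E) :
    push (extend σ) (Finsupp.single (stdVertex n) 1) = Finsupp.single σ 1 := by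
  rw [push_single]
  congr 1
  ext x
  rw [linearCombination_stdVertex, extend_apply]

theorem sbd_sbd {n : ℕ} (c : SingChain (n + 2) E) : sbd n (sbd (n + 1) c) = 0 := by
  refine LinearMap.congr_fun (f := (sbd n).comp (sbd (n + 1))) (g := 0) ?_ c
  refine Finsupp.lhom_ext' fun σ => LinearMap.ext_ring ?_
  simp only [LinearMap.comp_apply, Finsupp.lsingle_apply, LinearMap.zero_apply]
  rw [← push_extend_stdVertex, sbd_push, sbd_push, obd_obd, map_zero]

/-! ### Natural operators on affine chains -/

/-- An operator on affine chains of standard simplices acts on singular chains by its value on the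
universal simplex. -/
noncomputable def transfer {n k : ℕ}
    (O : OrdChain n (Fin n → ℝ) →ₗ[ZMod 2] OrdChain k (Fin n → ℝ)) :
    SingChain n E →ₗ[ZMod 2] SingChain k E :=
  Finsupp.linearCombination (ZMod 2) fun σ => push (extend σ) (O (Finsupp.single (stdVertex n) 1))

theorem transfer_single {n k : ℕ}
    (O : OrdChain n (Fin n → ℝ) →ₗ[ZMod 2] OrdChain k (Fin n → ℝ))
    (σ : stdSimplex ℝ (Fin n) → E) : transfer O (Finsupp.single σ 1) =
      push (extend σ) (O (Finsupp.single (stdVertex n) 1)) := by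
  simp [transfer]

/-- Operators on affine chains that commute with linear maps and preserve standard simplices. -/
structure IsNatural {n k : ℕ}
    (O : ∀ m, OrdChain n (Fin m → ℝ) →ₗ[ZMod 2] OrdChain k (Fin m → ℝ)) : Prop where
  omap_comm : ∀ m m' (L : (Fin m → ℝ) →ₗ[ℝ] (Fin m' → ℝ)) c, omap L (O m c) = O m' (omap L c)
  mem : ∀ m c, c ∈ ordIn n (stdSimplex ℝ (Fin m)) → O m c ∈ ordIn k (stdSimplex ℝ (Fin m))

/-- The action of a natural operator on singular chains is compatible with its action on the affine
chains of any standard simplex, by naturality for the affine map onto each affine simplex. -/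
theorem transfer_push {n k m : ℕ}
    {O : ∀ m, OrdChain n (Fin m → ℝ) →ₗ[ZMod 2] OrdChain k (Fin m → ℝ)} (hO : IsNatural O)
    (σ : stdSimplex ℝ (Fin m) → E) {c : OrdChain n (Fin m → ℝ)}
    (hc : c ∈ ordIn n (stdSimplex ℝ (Fin m))) :
    transfer (O n) (push (extend σ) c) = push (extend σ) (O m c) := by
  refine eq_of_mem_supported ((transfer (O n)).comp (push (extend σ)))
    ((push (extend σ)).comp (O m)) (fun p hp => ?_) hc
  rw [LinearMap.comp_apply, LinearMap.comp_apply, single_eq_omap p, ← hO.omap_comm,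
    push_omap, push_omap, push_single, transfer_single]
  refine push_congr (convex_stdSimplex ℝ _) (fun y hy => ?_) (hO.mem _ _ (stdVertex_mem n))
  rw [extend_of_mem _ hy]
  simp only [linearCombination_stdVertex]
  rfl

theorem transfer_mem {n k : ℕ}
    {O : ∀ m, OrdChain n (Fin m → ℝ) →ₗ[ZMod 2] OrdChain k (Fin m → ℝ)} (hO : IsNatural O)
    {A : Set E} {c : SingChain n E} (hc : c ∈ singIn n A) : transfer (O n) c ∈ singIn k A := by
  refine map_mem_of_mem_supported _ (fun σ hσ => ?_) hc
  rw [transfer_single]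
  refine push_mem (convex_stdSimplex ℝ _) (continuousOn_extend hσ.1) (fun y hy => ?_)
    (hO.mem _ _ (stdVertex_mem n))
  rw [extend_of_mem _ hy]
  exact hσ.2 _

end Singular

/-! ### Barycentric subdivision -/

section Subdivision

set_option linter.unusedSectionVars false

variable {F F' : Type} [NormedAddCommGroup F] [NormedSpace ℝ F]
  [NormedAddCommGroup F'] [NormedSpace ℝ F']

/-- The barycenter of a tuple of points. -/
noncomputable def barycenter {n : ℕ} (p : Fin (n + 1) → F) : F :=
  ((n : ℝ) + 1)⁻¹ • ∑ i, p i

theorem map_barycenter {n : ℕ} (L : F →ₗ[ℝ] F') (p : Fin (n + 1) → F) :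
    L (barycenter p) = barycenter (L ∘ p) := by
  simp [barycenter]

theorem barycenter_mem {n : ℕ} {D : Set F} (hD : Convex ℝ D) {p : Fin (n + 1) → F}
    (hp : ∀ i, p i ∈ D) : barycenter p ∈ D := by
  rw [barycenter, Finset.smul_sum]
  refine hD.sum_mem (fun i _ => by positivity) ?_ fun i _ => hp i
  rw [Finset.sum_const, Finset.card_univ, Fintype.card_fin, nsmul_eq_mul]
  push_cast
  exact mul_inv_cancel₀ (by positivity)

theorem dist_barycenter_le {n : ℕ} {p : Fin (n + 1) → F} {δ : ℝ}
    (h : ∀ i j, dist (p i) (p j) ≤ δ) (j : Fin (n + 1)) :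
    dist (p j) (barycenter p) ≤ (n / (n + 1) : ℝ) * δ := by
  have hn : (n : ℝ) + 1 ≠ 0 := by positivity
  have h1 : p j - barycenter p = ((n : ℝ) + 1)⁻¹ • ∑ i, (p j - p i) := by
    rw [Finset.sum_sub_distrib, smul_sub, barycenter, Finset.sum_const, Finset.card_univ,
      Fintype.card_fin, ← Nat.cast_smul_eq_nsmul ℝ, smul_smul]
    push_cast
    rw [inv_mul_cancel₀ hn, one_smul]
  have h2 : ‖∑ i, (p j - p i)‖ ≤ n * δ := by
    rw [← Finset.add_sum_erase _ _ (Finset.mem_univ j), sub_self, zero_add]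
    refine (norm_sum_le_of_le _ fun i _ => (dist_eq_norm (p j) (p i)) ▸ h j i).trans ?_
    rw [Finset.sum_const, Finset.card_erase_of_mem (Finset.mem_univ j), Finset.card_univ,
      Fintype.card_fin, nsmul_eq_mul, Nat.add_sub_cancel]
  rw [dist_eq_norm, h1, norm_smul, norm_inv, Real.norm_of_nonneg (by positivity : (0:ℝ) ≤ n + 1)]
  calc ((n : ℝ) + 1)⁻¹ * ‖∑ i, (p j - p i)‖ ≤ ((n : ℝ) + 1)⁻¹ * (n * δ) := by gcongr
    _ = (n / (n + 1) : ℝ) * δ := by field_simp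

/-- Barycentric subdivision of affine chains. -/
noncomputable def subdiv : ∀ n, OrdChain n F →ₗ[ZMod 2] OrdChain n F
  | 0 => LinearMap.id
  | n + 1 => Finsupp.linearCombination (ZMod 2) fun p =>
      ocone (barycenter p) (subdiv n (obd n (Finsupp.single p 1)))

theorem subdiv_single (n : ℕ) (p : Fin (n + 1) → F) : subdiv (n + 1) (Finsupp.single p 1) =
    ocone (barycenter p) (subdiv n (obd n (Finsupp.single p 1))) := by
  simp [subdiv]

theorem obd_subdiv (n : ℕ) (c : OrdChain (n + 1) F) :
    obd n (subdiv (n + 1) c) = subdiv n (obd n c) := by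
  induction n with
  | zero =>
    have h : (obd 0).comp (subdiv (0 + 1)) = (subdiv (F := F) 0).comp (obd 0) := by
      refine Finsupp.lhom_ext' fun p => LinearMap.ext_ring ?_
      simp only [LinearMap.comp_apply, Finsupp.lsingle_apply]
      rw [subdiv_single, obd_ocone_zero]
    simpa only [LinearMap.comp_apply] using LinearMap.congr_fun h c
  | succ n ih =>
    have h : (obd (n + 1)).comp (subdiv (n + 1 + 1)) =
        (subdiv (F := F) (n + 1)).comp (obd (n + 1)) := by
      refine Finsupp.lhom_ext' fun p => LinearMap.ext_ring ?_
      simp only [LinearMap.comp_apply, Finsupp.lsingle_apply]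
      rw [subdiv_single, obd_ocone, ih, obd_obd, map_zero, map_zero, add_zero]
    simpa only [LinearMap.comp_apply] using LinearMap.congr_fun h c

theorem omap_subdiv (L : F →ₗ[ℝ] F') (n : ℕ) (c : OrdChain n F) :
    omap L (subdiv n c) = subdiv n (omap L c) := by
  induction n with
  | zero => rfl
  | succ n ih =>
    refine LinearMap.congr_fun (f := (omap L).comp (subdiv (n + 1)))
      (g := (subdiv (n + 1)).comp (omap L)) ?_ c
    refine Finsupp.lhom_ext' fun p => LinearMap.ext_ring ?_
    simp only [LinearMap.comp_apply, Finsupp.lsingle_apply, subdiv_single, omap_single, omap_ocone,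
      ih, omap_obd, map_barycenter]

/-- Affine chains of simplices with vertices in `D` and of diameter at most `δ`. -/
noncomputable abbrev ordSmall (n : ℕ) (D : Set F) (δ : ℝ) : Submodule (ZMod 2) (OrdChain n F) :=
  Finsupp.supported _ _ {p | (∀ i, p i ∈ D) ∧ ∀ i j, dist (p i) (p j) ≤ δ}

/-- Subdivision shrinks the diameters of simplices with at most `N + 1` vertices by the factor
`N / (N + 1)`. -/
theorem subdiv_mem {N n : ℕ} (hn : n ≤ N + 1) {D : Set F} (hD : Convex ℝ D) {δ : ℝ} (hδ : 0 ≤ δ)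
    {c : OrdChain n F} (hc : c ∈ ordSmall n D δ) :
    subdiv n c ∈ ordSmall n D (N / (N + 1) * δ) := by
  induction n generalizing D with
  | zero => exact fun p _ => ⟨fun i => i.elim0, fun i => i.elim0⟩
  | succ n ih =>
    refine map_mem_of_mem_supported _ (fun p hp => ?_) hc
    have hrat : (n / (n + 1) : ℝ) * δ ≤ N / (N + 1) * δ := by
      refine mul_le_mul_of_nonneg_right ?_ hδ
      rw [div_le_div_iff₀ (by positivity) (by positivity)]
      have : (n : ℝ) ≤ N := by exact_mod_cast (by omega : n ≤ N)
      nlinarith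
    -- All vertices of the subdivided faces lie in a ball around the barycenter.
    have hball : ∀ i, p i ∈ D ∩ Metric.closedBall (barycenter p) (N / (N + 1) * δ) := fun i =>
      ⟨hp.1 i, (dist_barycenter_le hp.2 i).trans hrat⟩
    have hbd : obd n (Finsupp.single p 1) ∈
        ordSmall n (D ∩ Metric.closedBall (barycenter p) (N / (N + 1) * δ)) δ := by
      rw [obd_single]
      refine Submodule.sum_mem _ fun i _ => single_mem_supported ?_
      exact ⟨fun j => hball _, fun j k => hp.2 _ _⟩
    have h := ih (by omega) (hD.inter (convex_closedBall _ _)) hbd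
    rw [subdiv_single]
    refine map_mem_of_mem_supported _ (fun q hq => ?_) h
    rw [ocone_single]
    refine single_mem_supported ⟨fun i => ?_, fun i j => ?_⟩
    · refine Fin.cases ?_ (fun i => ?_) i
      · exact barycenter_mem hD hp.1
      · exact (hq.1 i).1
    · refine Fin.cases ?_ (fun i => ?_) i <;> refine Fin.cases ?_ (fun j => ?_) j
      · rw [dist_self]; positivity
      · simpa [dist_comm] using (hq.1 j).2
      · simpa using (hq.1 i).2
      · simpa using hq.2 i j

/-- Iterated subdivision. -/
noncomputable def iterSubdiv (m n : ℕ) : OrdChain n F →ₗ[ZMod 2] OrdChain n F :=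
  subdiv n ^ m

theorem iterSubdiv_succ (m n : ℕ) (c : OrdChain n F) :
    iterSubdiv (m + 1) n c = subdiv n (iterSubdiv m n c) := by
  rw [iterSubdiv, pow_succ']
  rfl

theorem iterSubdiv_zero (n : ℕ) (c : OrdChain n F) : iterSubdiv 0 n c = c := rfl

theorem obd_iterSubdiv (m n : ℕ) (c : OrdChain (n + 1) F) :
    obd n (iterSubdiv m (n + 1) c) = iterSubdiv m n (obd n c) := by
  induction m with
  | zero => rfl
  | succ m ih => rw [iterSubdiv_succ, iterSubdiv_succ, obd_subdiv, ih]

theorem omap_iterSubdiv (L : F →ₗ[ℝ] F') (m n : ℕ) (c : OrdChain n F) :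
    omap L (iterSubdiv m n c) = iterSubdiv m n (omap L c) := by
  induction m with
  | zero => rfl
  | succ m ih => rw [iterSubdiv_succ, iterSubdiv_succ, omap_subdiv, ih]

theorem iterSubdiv_mem {N n : ℕ} (hn : n ≤ N + 1) {D : Set F} (hD : Convex ℝ D) {δ : ℝ}
    (hδ : 0 ≤ δ) {c : OrdChain n F} (hc : c ∈ ordSmall n D δ) (m : ℕ) :
    iterSubdiv m n c ∈ ordSmall n D ((N / (N + 1)) ^ m * δ) := by
  induction m with
  | zero => simpa [iterSubdiv_zero] using hc
  | succ m ih =>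
    rw [iterSubdiv_succ, pow_succ', mul_assoc]
    exact subdiv_mem hn hD (by positivity) ih

theorem ordIn_le_ordSmall {n : ℕ} {D : Set F} (hD : Bornology.IsBounded D) {c : OrdChain n F}
    (hc : c ∈ ordIn n D) : c ∈ ordSmall n D (Metric.diam D) :=
  fun _ hp => ⟨hc hp, fun i j => Metric.dist_le_diam_of_mem hD (hc hp i) (hc hp j)⟩

theorem iterSubdiv_mem_ordIn {n : ℕ} {D : Set F} (hD : Convex ℝ D) (hb : Bornology.IsBounded D)
    {c : OrdChain n F} (hc : c ∈ ordIn n D) (m : ℕ) : iterSubdiv m n c ∈ ordIn n D :=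
  Finsupp.supported_mono (fun _ hp => hp.1)
    (iterSubdiv_mem (Nat.le_succ n) hD Metric.diam_nonneg (ordIn_le_ordSmall hb hc) m)

theorem isNatural_iterSubdiv (m n : ℕ) :
    IsNatural fun l => iterSubdiv (F := Fin l → ℝ) m n where
  omap_comm _ _ L c := omap_iterSubdiv L m n c
  mem _ _ hc := iterSubdiv_mem_ordIn (convex_stdSimplex ℝ _) (bounded_stdSimplex _) hc m

/-- The homotopy between the identity and iterated subdivision. -/
noncomputable def subdivHomotopy (m n : ℕ) : OrdChain n F →ₗ[ZMod 2] OrdChain (n + 1) F :=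
  coneHomotopy (fun n => LinearMap.id + iterSubdiv m n) id n

theorem isNatural_subdivHomotopy (m n : ℕ) :
    IsNatural fun l => subdivHomotopy (F := Fin l → ℝ) m n where
  omap_comm _ _ L c := omap_coneHomotopy L L
    (fun n c => by simp [omap_iterSubdiv]) (fun _ => rfl) n c
  mem _ _ hc := coneHomotopy_mem (fun n c hc => Submodule.add_mem _ hc
    (iterSubdiv_mem_ordIn (convex_stdSimplex ℝ _) (bounded_stdSimplex _) hc m)) (fun _ h => h) n hc

theorem iterSubdiv_dim_zero (m : ℕ) (c : OrdChain 0 F) : iterSubdiv m 0 c = c := by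
  induction m with
  | zero => rfl
  | succ m ih => rw [iterSubdiv_succ, ih]; rfl

theorem obd_subdivHomotopy (m n : ℕ) (c : OrdChain (n + 1) F) :
    obd (n + 1) (subdivHomotopy m (n + 1) c) + subdivHomotopy m n (obd n c) =
      c + iterSubdiv m (n + 1) c := by
  refine obd_coneHomotopy (fun n => LinearMap.id + iterSubdiv m n) id ?_ (fun n c => ?_) n c
  · refine LinearMap.ext fun c => ?_
    rw [LinearMap.add_apply, iterSubdiv_dim_zero, LinearMap.id_apply, ZModModule.add_self,
      LinearMap.zero_apply]
  · simp [obd_iterSubdiv]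

end Subdivision

section SingularSubdivision

set_option linter.unusedSectionVars false

variable {E : Type} [NormedAddCommGroup E] [NormedSpace ℝ E]

/-- Linear maps on singular chains agree if they agree on universal simplices pushed forward. -/
theorem single_induction {n : ℕ} {M : Type*} [AddCommGroup M] [Module (ZMod 2) M]
    (f g : SingChain n E →ₗ[ZMod 2] M)
    (h : ∀ σ, f (push (extend σ) (Finsupp.single (stdVertex n) 1)) =
      g (push (extend σ) (Finsupp.single (stdVertex n) 1))) (c : SingChain n E) : f c = g c := by
  refine LinearMap.congr_fun (f := f) (g := g) ?_ c
  refine Finsupp.lhom_ext' fun σ => LinearMap.ext_ring ?_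
  simpa only [push_extend_stdVertex, LinearMap.comp_apply, Finsupp.lsingle_apply] using h σ

/-- Iterated barycentric subdivision of singular chains. -/
noncomputable def singSubdiv (m n : ℕ) : SingChain n E →ₗ[ZMod 2] SingChain n E :=
  transfer (iterSubdiv m n)

theorem sbd_singSubdiv (m n : ℕ) (c : SingChain (n + 1) E) :
    sbd n (singSubdiv m (n + 1) c) = singSubdiv m n (sbd n c) := by
  have h := single_induction ((sbd n).comp (singSubdiv m (n + 1)))
    ((singSubdiv m n).comp (sbd (E := E) n)) (fun σ => ?_) c
  · simpa only [LinearMap.comp_apply] using h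
  have hι := stdVertex_mem (n + 1)
  simp only [LinearMap.comp_apply, singSubdiv]
  rw [transfer_push (isNatural_iterSubdiv m (n + 1)) σ hι, sbd_push, sbd_push,
    transfer_push (isNatural_iterSubdiv m n) σ (obd_mem hι), obd_iterSubdiv]

/-- A singular cycle is homologous to its subdivisions. -/
theorem exists_sbd_eq_add_singSubdiv (m : ℕ) {n : ℕ} {A : Set E} {c : SingChain (n + 1) E}
    (hc : c ∈ singIn (n + 1) A) (h0 : sbd n c = 0) :
    ∃ t ∈ singIn (n + 2) A, sbd (n + 1) t = c + singSubdiv m (n + 1) c := by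
  refine ⟨transfer (subdivHomotopy m (n + 1)) c,
    transfer_mem (isNatural_subdivHomotopy m (n + 1)) hc, ?_⟩
  have h : sbd (n + 1) (transfer (subdivHomotopy m (n + 1)) c) +
      transfer (subdivHomotopy m n) (sbd n c) = c + singSubdiv m (n + 1) c := by
    have h := single_induction ((sbd (n + 1)).comp (transfer (subdivHomotopy m (n + 1))) +
      (transfer (subdivHomotopy m n)).comp (sbd (E := E) n)) (LinearMap.id + singSubdiv m (n + 1))
      (fun σ => ?_) c
    · simpa only [LinearMap.comp_apply, LinearMap.add_apply, LinearMap.id_apply] using h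
    have hι := stdVertex_mem (n + 1)
    simp only [LinearMap.comp_apply, LinearMap.add_apply, LinearMap.id_apply, singSubdiv]
    rw [transfer_push (isNatural_iterSubdiv m (n + 1)) σ hι,
      transfer_push (isNatural_subdivHomotopy m (n + 1)) σ hι, sbd_push, sbd_push,
      transfer_push (isNatural_subdivHomotopy m n) σ (obd_mem hι), ← map_add, obd_subdivHomotopy,
      map_add]
  rwa [h0, map_zero, add_zero] at h

/-- Singular chains of `A` formed by simplices of diameter less than `ε`. -/
noncomputable abbrev singSmall (n : ℕ) (A : Set E) (ε : ℝ) : Submodule (ZMod 2) (SingChain n E) :=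
  Finsupp.supported _ _ {σ | (Continuous σ ∧ ∀ x, σ x ∈ A) ∧ ∀ x y, dist (σ x) (σ y) < ε}

theorem dist_linearCombination_le {n : ℕ} {F : Type} [NormedAddCommGroup F] [NormedSpace ℝ F]
    {q : Fin n → F} {δ : ℝ} (h : ∀ i j, dist (q i) (q j) ≤ δ) (x y : stdSimplex ℝ (Fin n)) :
    dist (Fintype.linearCombination ℝ q x) (Fintype.linearCombination ℝ q y) ≤ δ := by
  have h1 : ∀ j, Fintype.linearCombination ℝ q y ∈ Metric.closedBall (q j) δ := fun j =>
    linearCombination_mem (convex_closedBall _ _) (fun i => h i j) y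
  exact linearCombination_mem (convex_closedBall (Fintype.linearCombination ℝ q y) δ)
    (fun i => by rw [Metric.mem_closedBall, dist_comm]; exact h1 i) x

/-- Sufficiently fine subdivisions of a singular chain are small. -/
theorem eventually_singSubdiv_mem {n : ℕ} {A : Set E} {c : SingChain n E} (hc : c ∈ singIn n A)
    {ε : ℝ} (hε : 0 < ε) : ∀ᶠ m in Filter.atTop, singSubdiv m n c ∈ singSmall n A ε := by
  have key : ∀ σ ∈ c.support, ∀ᶠ m in Filter.atTop,
      singSubdiv m n (Finsupp.single σ 1) ∈ singSmall n A ε := by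
    intro σ hσc
    have hσ : Continuous σ ∧ ∀ x, σ x ∈ A := hc hσc
    have hcomp : CompactSpace (stdSimplex ℝ (Fin n)) :=
      isCompact_iff_compactSpace.1 (isCompact_stdSimplex ℝ _)
    obtain ⟨η, hη, hση⟩ := Metric.uniformContinuous_iff.1
      (CompactSpace.uniformContinuous_of_continuous hσ.1) ε hε
    have hlim : Filter.Tendsto (fun m : ℕ => ((n : ℝ) / (n + 1)) ^ m *
        Metric.diam (stdSimplex ℝ (Fin n))) Filter.atTop (nhds 0) := by
      have h1 : (n : ℝ) / (n + 1) < 1 := by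
        rw [div_lt_one (by positivity)]
        linarith
      simpa using (tendsto_pow_atTop_nhds_zero_of_lt_one (by positivity) h1).mul_const
        (Metric.diam (stdSimplex ℝ (Fin n)))
    filter_upwards [hlim.eventually (gt_mem_nhds hη)] with m hm
    rw [singSubdiv, transfer_single]
    refine map_mem_of_mem_supported _ (fun q hq => ?_) (iterSubdiv_mem (Nat.le_succ n)
      (convex_stdSimplex ℝ _) Metric.diam_nonneg
      (ordIn_le_ordSmall (bounded_stdSimplex _) (stdVertex_mem n)) m)
    have hq' : ∀ x : stdSimplex ℝ (Fin n),
        Fintype.linearCombination ℝ q x ∈ stdSimplex ℝ (Fin n) :=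
      linearCombination_mem (convex_stdSimplex ℝ _) hq.1
    have h1 : push (extend σ) (Finsupp.single q 1) ∈ singIn n A :=
      push_mem (convex_stdSimplex ℝ _) (continuousOn_extend hσ.1)
        (fun y hy => extend_of_mem σ hy ▸ hσ.2 _) (single_mem_supported hq.1)
    rw [push_single] at h1 ⊢
    have h2 := h1 (by simp : (fun x : stdSimplex ℝ (Fin n) =>
      extend σ (Fintype.linearCombination ℝ q x)) ∈ _)
    refine single_mem_supported ⟨h2, fun x y => ?_⟩
    simp only [extend_of_mem σ (hq' _)]
    exact hση ((dist_linearCombination_le hq.2 x y).trans_lt hm)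
  filter_upwards [(Filter.eventually_all_finset c.support).2 key] with m hm
  refine map_mem_of_mem_supported (s := c.support) _ (fun σ hσ => hm σ hσ) ?_
  exact (Finsupp.mem_supported _ _).2 subset_rfl

end SingularSubdivision

/-! ### Straight-line homotopies -/

section Prism

set_option linter.unusedSectionVars false

variable {E : Type} [NormedAddCommGroup E] [NormedSpace ℝ E]

/-- The difference between the bottom and the top of a prism, the height being the second
coordinate. -/
noncomputable def prismEnds (F : Type) (n : ℕ) : OrdChain n F →ₗ[ZMod 2] OrdChain n (F × ℝ) :=
  omap (fun x => (x, 0)) + omap (fun x => (x, 1))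

/-- The prism over an affine simplex. -/
noncomputable def prism (F : Type) (n : ℕ) : OrdChain n F →ₗ[ZMod 2] OrdChain (n + 1) (F × ℝ) :=
  coneHomotopy (prismEnds F) (fun x => (x, 0)) n

theorem obd_prism {F : Type} (n : ℕ) (c : OrdChain (n + 1) F) :
    obd (n + 1) (prism F (n + 1) c) + prism F n (obd n c) = prismEnds F (n + 1) c := by
  refine obd_coneHomotopy _ _ ?_ (fun n c => ?_) n c
  · refine Finsupp.lhom_ext' fun p => LinearMap.ext_ring ?_
    simp only [prismEnds, LinearMap.comp_apply, Finsupp.lsingle_apply, LinearMap.add_apply,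
      omap_single, LinearMap.zero_apply]
    rw [Subsingleton.elim ((fun x => (x, (0 : ℝ))) ∘ p) ((fun x => (x, (1 : ℝ))) ∘ p),
      ZModModule.add_self]
  · simp [prismEnds, omap_obd]

theorem prism_mem {F : Type} {n : ℕ} {D : Set F} {c : OrdChain n F} (hc : c ∈ ordIn n D) :
    prism F n c ∈ ordIn (n + 1) (D ×ˢ Set.Icc (0 : ℝ) 1) := by
  have h : ∀ t ∈ Set.Icc (0 : ℝ) 1, ∀ n, ∀ c ∈ ordIn n D,
      omap (fun x => (x, t)) c ∈ ordIn n (D ×ˢ Set.Icc (0 : ℝ) 1) := by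
    intro t ht n c hc
    refine map_mem_of_mem_supported _ (fun p hp => ?_) hc
    rw [omap_single]
    exact single_mem_supported fun i => ⟨hp i, ht⟩
  exact coneHomotopy_mem (Q := D ×ˢ Set.Icc (0 : ℝ) 1) (fun n c hc => Submodule.add_mem _
    (h 0 (by simp) n c hc) (h 1 (by simp) n c hc)) (fun x hx => Set.mk_mem_prod hx (by simp)) n hc

theorem omap_prism {F F' : Type} (f : F → F') (n : ℕ) (c : OrdChain n F) :
    omap (fun z : F × ℝ => (f z.1, z.2)) (prism F n c) = prism F' n (omap f c) := by
  have h : ∀ (t : ℝ) n (c : OrdChain n F),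
      omap (fun z : F × ℝ => (f z.1, z.2)) (omap (fun x => (x, t)) c) =
        omap (fun x => (x, t)) (omap f c) := by
    intro t n c
    simp only [omap, Finsupp.lmapDomain_apply, ← Finsupp.mapDomain_comp]
    rfl
  refine omap_coneHomotopy (r := prismEnds F) (r' := prismEnds F') (g := fun x => (x, (0 : ℝ)))
    (g' := fun x => (x, (0 : ℝ))) f (fun z : F × ℝ => (f z.1, z.2)) (fun n c => ?_)
    (fun x => rfl) n c
  simp only [prismEnds, LinearMap.add_apply, map_add, h]

/-- The straight line homotopy from `σ` to the affine simplex whose vertices are the images under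
`u` of the vertices of `σ`. -/
noncomputable def lineHomotopy (u : E → E) {n : ℕ} (σ : stdSimplex ℝ (Fin n) → E) :
    (Fin n → ℝ) × ℝ → E :=
  fun z => (1 - z.2) • extend σ z.1 +
    z.2 • Fintype.linearCombination ℝ (fun i => u (σ (stdSimplex.vertex i))) z.1

/-- The affine simplices spanned by the images under `u` of the vertices. -/
noncomputable def straighten (u : E → E) (n : ℕ) : SingChain n E →ₗ[ZMod 2] SingChain n E :=
  Finsupp.linearCombination (ZMod 2) fun σ =>
    push id (Finsupp.single (fun i => u (σ (stdSimplex.vertex i))) 1)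

theorem straighten_single (u : E → E) {n : ℕ} (σ : stdSimplex ℝ (Fin n) → E) :
    straighten u n (Finsupp.single σ 1) =
      push id (Finsupp.single (fun i => u (σ (stdSimplex.vertex i))) 1) := by
  simp [straighten]

/-- The prism operator of the straight line homotopies. -/
noncomputable def singPrism (u : E → E) (n : ℕ) : SingChain n E →ₗ[ZMod 2] SingChain (n + 1) E :=
  Finsupp.linearCombination (ZMod 2) fun σ =>
    push (lineHomotopy u σ) (prism _ n (Finsupp.single (stdVertex n) 1))

theorem singPrism_single (u : E → E) {n : ℕ} (σ : stdSimplex ℝ (Fin n) → E) :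
    singPrism u n (Finsupp.single σ 1) =
      push (lineHomotopy u σ) (prism _ n (Finsupp.single (stdVertex n) 1)) := by
  simp [singPrism]

/-- The prism operator is compatible with faces, since the straight line homotopy of a face of `σ`
is the restriction of that of `σ`. -/
theorem singPrism_face (u : E → E) {n : ℕ} (σ : stdSimplex ℝ (Fin (n + 1)) → E) (i : Fin (n + 1)) :
    singPrism u n (Finsupp.single (σ ∘ stdSimplex.map i.succAbove) 1) =
      push (lineHomotopy u σ) (prism _ n (Finsupp.single (stdVertex (n + 1) ∘ i.succAbove) 1)) := by
  let L : (Fin n → ℝ) →ₗ[ℝ] (Fin (n + 1) → ℝ) :=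
    Fintype.linearCombination ℝ (stdVertex (n + 1) ∘ i.succAbove)
  have hL : ∀ x : stdSimplex ℝ (Fin n),
      L x = (stdSimplex.map i.succAbove x : stdSimplex ℝ (Fin (n + 1))) := fun x => by
    rw [← linearCombination_stdVertex
      (stdSimplex.map i.succAbove x : stdSimplex ℝ (Fin (n + 1))), linearCombination_map]
  rw [singPrism_single, single_eq_omap (stdVertex (n + 1) ∘ i.succAbove), ← omap_prism]
  have hpush := push_omap (lineHomotopy u σ) (L.prodMap LinearMap.id)
    (prism _ n (Finsupp.single (stdVertex n) 1))
  refine Eq.trans ?_ hpush.symm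
  refine push_congr ((convex_stdSimplex ℝ _).prod (convex_Icc 0 1)) (fun z hz => ?_)
    (prism_mem (stdVertex_mem n))
  obtain ⟨y, t⟩ := z
  obtain ⟨hy, -⟩ := hz
  have h1 : L y = (stdSimplex.map i.succAbove ⟨y, hy⟩ : stdSimplex ℝ (Fin (n + 1))) := hL ⟨y, hy⟩
  simp only [lineHomotopy, Function.comp_apply, LinearMap.prodMap_apply, LinearMap.id_apply, h1]
  rw [extend_of_mem _ hy, linearCombination_map]
  simp only [Function.comp_apply, stdSimplex.map_vertex]
  congr 2
  exact (extend_apply σ _).symm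

/-- The prism operator is a homotopy between the identity and straightening. -/
theorem sbd_singPrism (u : E → E) (n : ℕ) (c : SingChain (n + 1) E) :
    sbd (n + 1) (singPrism u (n + 1) c) + singPrism u n (sbd n c) =
      c + straighten u (n + 1) c := by
  have h : (sbd (n + 1)).comp (singPrism u (n + 1)) + (singPrism u n).comp (sbd n) =
      LinearMap.id + straighten u (n + 1) := by
    refine Finsupp.lhom_ext' fun σ => LinearMap.ext_ring ?_
    simp only [LinearMap.comp_apply, LinearMap.add_apply, LinearMap.id_apply,
      Finsupp.lsingle_apply, sbd_single, map_sum, singPrism_face]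
    rw [singPrism_single, sbd_push, ← map_sum, ← map_sum, ← obd_single, ← map_add, obd_prism,
      prismEnds, LinearMap.add_apply, map_add, omap_single, omap_single, push_single, push_single,
      straighten_single, push_single]
    have hlc : ∀ (t : ℝ) (x : stdSimplex ℝ (Fin (n + 1))), Fintype.linearCombination ℝ
        ((fun x => (x, t)) ∘ stdVertex (n + 1)) x = ((x : Fin (n + 1) → ℝ), t) := by
      intro t x
      have h1 := linearCombination_stdVertex (x : Fin (n + 1) → ℝ)
      rw [Fintype.linearCombination_apply] at h1 ⊢
      refine Prod.ext ?_ ?_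
      · rw [Prod.fst_sum]; exact h1
      · rw [Prod.snd_sum]
        simp only [Function.comp_apply, Prod.smul_snd, smul_eq_mul, ← Finset.sum_mul]
        rw [stdSimplex.sum_eq_one, one_mul]
    simp only [hlc]
    congr 2
    · ext x
      simp [lineHomotopy, extend_apply]
    · ext x
      simp [lineHomotopy]
  simpa only [LinearMap.comp_apply, LinearMap.add_apply, LinearMap.id_apply] using
    LinearMap.congr_fun h c

theorem continuousOn_lineHomotopy (u : E → E) {n : ℕ} {σ : stdSimplex ℝ (Fin n) → E}
    (hσ : Continuous σ) : ContinuousOn (lineHomotopy u σ)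
      (stdSimplex ℝ (Fin n) ×ˢ Set.Icc (0 : ℝ) 1) := by
  have h1 : ContinuousOn (fun z : (Fin n → ℝ) × ℝ => extend σ z.1)
      (stdSimplex ℝ (Fin n) ×ˢ Set.Icc (0 : ℝ) 1) :=
    (continuousOn_extend hσ).comp continuous_fst.continuousOn fun z hz => hz.1
  unfold lineHomotopy
  refine ContinuousOn.add (ContinuousOn.smul (by fun_prop) h1) ?_
  simp only [Fintype.linearCombination_apply]
  fun_prop

/-- The prism operator stays in any set containing the straight line homotopies. -/
theorem singPrism_mem {u : E → E} {n : ℕ} {A : Set E} {s : Set (stdSimplex ℝ (Fin n) → E)}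
    (hs : ∀ σ ∈ s, Continuous σ ∧ ∀ y ∈ stdSimplex ℝ (Fin n), ∀ t ∈ Set.Icc (0 : ℝ) 1,
      lineHomotopy u σ (y, t) ∈ A) {c : SingChain n E}
    (hc : c ∈ Finsupp.supported (ZMod 2) (ZMod 2) s) : singPrism u n c ∈ singIn (n + 1) A := by
  refine map_mem_of_mem_supported _ (fun σ hσ => ?_) hc
  rw [singPrism_single]
  exact push_mem ((convex_stdSimplex ℝ _).prod (convex_Icc 0 1))
    (continuousOn_lineHomotopy u (hs σ hσ).1) (fun z hz => (hs σ hσ).2 _ hz.1 _ hz.2)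
    (prism_mem (stdVertex_mem n))

end Prism

/-! ### Comparison with simplicial chains -/

section Approximation

set_option linter.unusedSectionVars false

variable {V : Type} [Fintype V] [DecidableEq V]

/-- The ordered simplicial chain obtained by rounding the vertices of singular simplices by means of
a map `r`, which need not be continuous. -/
noncomputable def round {E : Type} (r : E → V) (n : ℕ) : SingChain n E →ₗ[ZMod 2] OrdChain n V :=
  Finsupp.lmapDomain _ _ fun σ i => r (σ (stdSimplex.vertex i))

theorem round_single {E : Type} (r : E → V) {n : ℕ} (σ : stdSimplex ℝ (Fin n) → E) :
    round r n (Finsupp.single σ 1) = Finsupp.single (fun i => r (σ (stdSimplex.vertex i))) 1 := by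
  simp [round]

theorem round_sbd {E : Type} (r : E → V) (n : ℕ) (c : SingChain (n + 1) E) :
    round r n (sbd n c) = obd n (round r (n + 1) c) := by
  have h : (round r n).comp (sbd n) = (obd n).comp (round r (n + 1)) := by
    refine Finsupp.lhom_ext' fun σ => LinearMap.ext_ring ?_
    simp only [LinearMap.comp_apply, Finsupp.lsingle_apply, sbd_single, map_sum, round_single,
      obd_single]
    refine Finset.sum_congr rfl fun i _ => ?_
    congr 1
    ext j
    simp only [Function.comp_apply, stdSimplex.map_vertex]
  simpa only [LinearMap.comp_apply] using LinearMap.congr_fun h c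

/-- The vertex of the standard simplex on `V` corresponding to `v`. -/
def vertexPoint (v : V) : V → ℝ := Pi.single v 1

/-- Realization of ordered simplicial chains by affine simplices. -/
noncomputable def realize (n : ℕ) : OrdChain n V →ₗ[ZMod 2] SingChain n (V → ℝ) :=
  (push id).comp (omap vertexPoint)

theorem sbd_realize (n : ℕ) (c : OrdChain (n + 1) V) :
    sbd n (realize (n + 1) c) = realize n (obd n c) := by
  rw [realize, realize, LinearMap.comp_apply, LinearMap.comp_apply, sbd_push, omap_obd]

theorem realize_round (r : (V → ℝ) → V) (n : ℕ) (c : SingChain n (V → ℝ)) :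
    realize n (round r n c) = straighten (fun y => vertexPoint (r y)) n c := by
  have h : (realize n).comp (round r n) = straighten (fun y => vertexPoint (r y)) n := by
    refine Finsupp.lhom_ext' fun σ => LinearMap.ext_ring ?_
    simp only [LinearMap.comp_apply, Finsupp.lsingle_apply, round_single, realize, omap_single,
      straighten_single]
    rfl
  simpa only [LinearMap.comp_apply] using LinearMap.congr_fun h c

/-- The closed face of the standard simplex spanned by `s`. -/
def closedFace (s : Finset V) : Set (V → ℝ) := {x | x ∈ stdSimplex ℝ V ∧ ∀ v, v ∉ s → x v = 0}

theorem convex_closedFace (s : Finset V) : Convex ℝ (closedFace s) := by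
  intro x hx y hy a b ha hb hab
  refine ⟨convex_stdSimplex ℝ V hx.1 hy.1 ha hb hab, fun v hv => ?_⟩
  simp [hx.2 v hv, hy.2 v hv]

theorem vertexPoint_mem_closedFace {s : Finset V} {v : V} (hv : v ∈ s) :
    vertexPoint v ∈ closedFace s := by
  refine ⟨single_mem_stdSimplex ℝ v, fun w hw => ?_⟩
  rw [vertexPoint, Pi.single_eq_of_ne]
  rintro rfl
  exact hw hv

theorem closedFace_subset_realization {K : AbstractSimplicialComplex V} {s : Finset V}
    (hs : s ∈ K.faces) : closedFace s ⊆ realization K := fun _ hx => ⟨hx.1, s, hs, hx.2⟩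

theorem realize_mem {K : AbstractSimplicialComplex V} {H : Set (V → ℝ)} (hH : Convex ℝ H)
    {W : Finset V} (hW : ∀ v ∈ W, vertexPoint v ∈ H) {n : ℕ} {c : OrdChain n V}
    (hc : c ∈ ordFaces K W n) : realize n c ∈ singIn n (realization K ∩ H) := by
  refine map_mem_of_mem_supported _ (fun p hp => ?_) hc
  rw [realize, LinearMap.comp_apply, omap_single]
  refine push_mem (A := realization K ∩ H) ((convex_closedFace (Finset.univ.image p)).inter hH)
    continuous_id.continuousOn
    (fun y hy => ⟨closedFace_subset_realization hp.2 hy.1, hy.2⟩) (single_mem_supported ?_)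
  intro i
  exact ⟨vertexPoint_mem_closedFace (Finset.mem_image_of_mem _ (Finset.mem_univ _)), hW _ (hp.1 i)⟩

/-- The vertices rounding a small simplex in the realization lie in the support of each of its
points. -/
theorem round_mem_face {K : AbstractSimplicialComplex V} {ε : ℝ} {r : (V → ℝ) → V}
    (hr : ∀ y ∈ realization K, ε ≤ y (r y)) {n : ℕ} {σ : stdSimplex ℝ (Fin n) → V → ℝ}
    (hσ : ∀ x, σ x ∈ realization K) (hsmall : ∀ x y, dist (σ x) (σ y) < ε)
    (x : stdSimplex ℝ (Fin n)) : ∃ s ∈ K.faces, σ x ∈ closedFace s ∧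
      ∀ i, r (σ (stdSimplex.vertex i)) ∈ s := by
  obtain ⟨h1, s, hs, h2⟩ := hσ x
  refine ⟨s, hs, ⟨h1, h2⟩, fun i => ?_⟩
  by_contra hi
  have h3 := h2 _ hi
  have h4 := hr _ (hσ (stdSimplex.vertex i))
  have h5 := (dist_le_pi_dist (σ (stdSimplex.vertex i)) (σ x)
    (r (σ (stdSimplex.vertex i)))).trans_lt (hsmall _ _)
  rw [h3, Real.dist_eq, sub_zero] at h5
  exact absurd (h4.trans (le_abs_self _)) (not_le.2 h5)

theorem round_mem {K : AbstractSimplicialComplex V} {ε : ℝ} {r : (V → ℝ) → V} {W : Finset V}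
    {A : Set (V → ℝ)} (hA : A ⊆ realization K) (hr : ∀ y ∈ realization K, ε ≤ y (r y))
    (hrA : ∀ y ∈ A, r y ∈ W) {n : ℕ} {c : SingChain (n + 1) (V → ℝ)}
    (hc : c ∈ singSmall (n + 1) A ε) : round r (n + 1) c ∈ ordFaces K W (n + 1) := by
  refine map_mem_of_mem_supported _ (fun σ hσ => ?_) hc
  rw [round_single]
  refine single_mem_supported ?_
  refine ⟨fun i => hrA _ (hσ.1.2 _), ?_⟩
  obtain ⟨s, hs, -, h⟩ := round_mem_face hr (fun x => hA (hσ.1.2 x)) hσ.2 (stdSimplex.vertex 0)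
  refine (K.isRelLowerSet_faces hs).2 ?_ (Finset.univ_nonempty.image _)
  intro v hv
  obtain ⟨i, -, rfl⟩ := Finset.mem_image.1 hv
  exact h i

/-- If each point of `A` has a positive coordinate in `W`, then on a singular chain of `A`, whose
image is compact, some coordinate in `W` is bounded below by a positive constant. -/
theorem exists_pos_lower_bound {A : Set (V → ℝ)} {W : Finset V}
    (hA : ∀ y ∈ A, ∃ v ∈ W, 0 < y v) {n : ℕ} {c : SingChain n (V → ℝ)} (hc : c ∈ singIn n A) :
    ∃ ε > 0, c ∈ singIn n {y ∈ A | ∃ v ∈ W, ε ≤ y v} := by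
  have hcomp : CompactSpace (stdSimplex ℝ (Fin n)) :=
    isCompact_iff_compactSpace.1 (isCompact_stdSimplex ℝ _)
  have key : ∀ σ ∈ c.support, ∀ᶠ ε in nhdsWithin (0 : ℝ) (Set.Ioi 0),
      ∀ x, ∃ v ∈ W, ε ≤ σ x v := by
    intro σ hσ
    obtain ⟨hcont, hmem⟩ := hc hσ
    rcases isEmpty_or_nonempty (stdSimplex ℝ (Fin n)) with he | hne
    · exact Filter.Eventually.of_forall fun ε x => he.elim x
    obtain ⟨v₀, hv₀, -⟩ := hA _ (hmem hne.some)
    have hW : W.Nonempty := ⟨v₀, hv₀⟩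
    have hsup : Continuous fun x => W.sup' hW fun v => σ x v :=
      Continuous.finset_sup'_apply hW fun v _ => (continuous_apply v).comp hcont
    obtain ⟨x₀, -, hx₀⟩ := isCompact_univ.exists_isMinOn Set.univ_nonempty hsup.continuousOn
    have hpos : 0 < W.sup' hW fun v => σ x₀ v := by
      obtain ⟨v, hv, h⟩ := hA _ (hmem x₀)
      exact h.trans_le (Finset.le_sup' (fun v => σ x₀ v) hv)
    filter_upwards [nhdsWithin_le_nhds (gt_mem_nhds hpos)] with ε hε x
    obtain ⟨v, hv, h⟩ := Finset.exists_mem_eq_sup' hW fun v => σ x v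
    exact ⟨v, hv, h ▸ hε.le.trans (hx₀ (Set.mem_univ x))⟩
  obtain ⟨ε, hε, hε0⟩ := (((Filter.eventually_all_finset c.support).2 key).and
    self_mem_nhdsWithin).exists
  exact ⟨ε, hε0, fun σ hσ => ⟨(hc hσ).1, fun x => ⟨(hc hσ).2 x, hε σ hσ x⟩⟩⟩

/-- Reduction of singular homology to simplicial homology: if cycles of `K[W]` bounding in `K`
bound in `K[W]`, then the same holds for singular cycles of `|K| ∩ H`, where `H` is a convex set
whose points in `|K|` have a vertex of `W` in their support. -/
theorem exists_sbd_eq {K : AbstractSimplicialComplex V} {H : Set (V → ℝ)} (hH : Convex ℝ H)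
    {W : Finset V} (hW : ∀ v ∈ W, vertexPoint v ∈ H)
    (hHW : ∀ y ∈ realization K ∩ H, ∃ v ∈ W, 0 < y v) {k : ℕ}
    (hinj : ∀ c ∈ ordFaces K W (k + 1), ∀ e ∈ ordFaces K Finset.univ (k + 2),
      obd (k + 1) e = c → ∃ e' ∈ ordFaces K W (k + 2), obd (k + 1) e' = c)
    {c : SingChain (k + 1) (V → ℝ)} {e : SingChain (k + 2) (V → ℝ)}
    (hc : c ∈ singIn (k + 1) (realization K ∩ H)) (he : e ∈ singIn (k + 2) (realization K))
    (hec : sbd (k + 1) e = c) :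
    ∃ e' ∈ singIn (k + 2) (realization K ∩ H), sbd (k + 1) e' = c := by
  classical
  rcases isEmpty_or_nonempty V with hV | hV
  · refine ⟨0, Submodule.zero_mem _, ?_⟩
    rw [map_zero]
    by_contra h
    obtain ⟨σ, hσ⟩ := Finsupp.support_nonempty_iff.2 (Ne.symm h)
    obtain ⟨v, -⟩ := hHW _ ((hc hσ).2 (stdSimplex.vertex 0))
    exact hV.elim v
  obtain ⟨ε₀, hε₀, hcε₀⟩ := exists_pos_lower_bound hHW hc
  set n := (Fintype.card V : ℝ) with hn
  have hn0 : 0 < n := by rw [hn]; exact_mod_cast Fintype.card_pos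
  -- In the standard simplex on `V` some coordinate is at least `1 / n`.
  set ε := min ε₀ n⁻¹ with hεdef
  have hε : 0 < ε := lt_min hε₀ (inv_pos.2 hn0)
  set A : Set (V → ℝ) := {y ∈ realization K ∩ H | ∃ v ∈ W, ε ≤ y v} with hAdef
  have hcA : c ∈ singIn (k + 1) A := fun σ hσ => ⟨(hc hσ).1, fun x => ⟨(hc hσ).2 x, by
    obtain ⟨-, v, hv, h⟩ := (hcε₀ hσ).2 x
    exact ⟨v, hv, (min_le_left _ _).trans h⟩⟩⟩
  -- The rounding map prefers vertices of `W` with a large coordinate.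
  have hlarge : ∀ y ∈ realization K, ∃ v, ε ≤ y v := by
    intro y hy
    by_contra! h
    have h1 : ∑ v, y v < ∑ _v : V, n⁻¹ :=
      Finset.sum_lt_sum_of_nonempty Finset.univ_nonempty fun v _ =>
        (h v).trans_le (min_le_right _ _)
    rw [hy.1.2, Finset.sum_const, Finset.card_univ, nsmul_eq_mul, mul_inv_cancel₀ hn0.ne'] at h1
    exact lt_irrefl _ h1
  let r : (V → ℝ) → V := fun y =>
    if h : ∃ v ∈ W, ε ≤ y v then h.choose else
      if h : ∃ v, ε ≤ y v then h.choose else Classical.arbitrary V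
  have hr : ∀ y ∈ realization K, ε ≤ y (r y) := by
    intro y hy
    by_cases h : ∃ v ∈ W, ε ≤ y v
    · simp only [r, dif_pos h]
      exact h.choose_spec.2
    · simp only [r, dif_neg h, dif_pos (hlarge y hy)]
      exact (hlarge y hy).choose_spec
  have hrA : ∀ y ∈ A, r y ∈ W := by
    intro y hy
    simp only [r, dif_pos hy.2]
    exact hy.2.choose_spec.1
  have hAK : A ⊆ realization K := fun y hy => hy.1.1
  obtain ⟨m, hmc, hme⟩ := ((eventually_singSubdiv_mem hcA hε).and
    (eventually_singSubdiv_mem he hε)).exists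
  have hc0 : sbd k c = 0 := by rw [← hec, sbd_sbd]
  obtain ⟨t, ht, htc⟩ := exists_sbd_eq_add_singSubdiv m hc hc0
  set c₁ := singSubdiv m (k + 1) c with hc₁
  have hc₁0 : sbd k c₁ = 0 := by rw [hc₁, sbd_singSubdiv, hc0, map_zero]
  -- The rounded cycle bounds in `K[W]`.
  obtain ⟨g, hg, hgc⟩ := hinj (round r (k + 1) c₁) (round_mem hAK hr hrA hmc)
    (round r (k + 2) (singSubdiv m (k + 2) e))
    (round_mem subset_rfl hr (fun _ _ => Finset.mem_univ _) hme)
    (by rw [← round_sbd, sbd_singSubdiv, hec])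
  have hline : singPrism (fun y => vertexPoint (r y)) (k + 1) c₁ ∈
      singIn (k + 2) (realization K ∩ H) := by
    refine singPrism_mem (fun σ hσ => ⟨hσ.1.1, fun y hy s hs => ?_⟩) hmc
    obtain ⟨f, hf, hyf, hrf⟩ := round_mem_face hr (fun x => hAK (hσ.1.2 x)) hσ.2 ⟨y, hy⟩
    have hconv := (convex_closedFace f).inter hH
    have h1 : σ ⟨y, hy⟩ ∈ closedFace f ∩ H := ⟨hyf, (hσ.1.2 _).1.2⟩
    have h2 : Fintype.linearCombination ℝ
        (fun i => vertexPoint (r (σ (stdSimplex.vertex i)))) y ∈ closedFace f ∩ H :=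
      linearCombination_mem hconv (fun i => ⟨vertexPoint_mem_closedFace (hrf i),
        hW _ (hrA _ (hσ.1.2 _))⟩) ⟨y, hy⟩
    have h3 := hconv h1 h2 (sub_nonneg.2 hs.2) hs.1 (by ring)
    rw [lineHomotopy, extend_of_mem _ hy]
    exact ⟨closedFace_subset_realization hf h3.1, h3.2⟩
  have hprism := sbd_singPrism (fun y => vertexPoint (r y)) k c₁
  rw [hc₁0, map_zero, add_zero, ← realize_round, ← hgc, ← sbd_realize] at hprism
  refine ⟨t + singPrism (fun y => vertexPoint (r y)) (k + 1) c₁ + realize (k + 2) g,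
    Submodule.add_mem _ (Submodule.add_mem _ ht hline) (realize_mem hH hW hg), ?_⟩
  rw [map_add, map_add, htc, hprism]
  linear_combination (norm := module) ZModModule.add_self c₁ +
    ZModModule.add_self (sbd (k + 1) (realize (k + 2) g))

end Approximation

/-! ### Mathlib's singular homology -/

section Bridge

open CategoryTheory AlgebraicTopology Limits
open scoped Simplicial

/-- A chain map is injective on homology in degree `i` if every chain whose image is a boundary is
itself a boundary. If the map is injective, only cycles have this property. -/
theorem homologyMap_injective {R : Type} [Ring R] {C D : ChainComplex (ModuleCat.{0} R) ℕ}
    (φ : C ⟶ D) (i : ℕ)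
    (h : ∀ x : C.X i, (∃ y : D.X (i + 1), (D.d (i + 1) i).hom y = (φ.f i).hom x) →
      ∃ z : C.X (i + 1), (C.d (i + 1) i).hom z = x) :
    Function.Injective (HomologicalComplex.homologyMap φ i).hom := by
  have hrange : ∀ (C : ChainComplex (ModuleCat.{0} R) ℕ) (x : C.X i),
      (C.pOpcycles i).hom x = 0 ↔ ∃ y : C.X (i + 1), (C.d (i + 1) i).hom y = x := by
    intro C x
    have h1 := (C.sc i).moduleCat_pOpcycles_eq_zero_iff x
    have h2 : (ComplexShape.down ℕ).prev i = i + 1 := ChainComplex.prev ℕ i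
    rw [← h2]
    exact h1
  rw [injective_iff_map_eq_zero]
  intro a ha
  obtain ⟨z, rfl⟩ := (ModuleCat.epi_iff_surjective (C.homologyπ i)).1 inferInstance a
  have hι := (ModuleCat.mono_iff_injective (C.homologyι i)).1 inferInstance
  refine hι ?_
  have h1 : C.homologyπ i ≫ HomologicalComplex.homologyMap φ i ≫ D.homologyι i =
      C.iCycles i ≫ φ.f i ≫ D.pOpcycles i := by simp
  have h2 := congr(($h1).hom z)
  have h3 : C.homologyπ i ≫ C.homologyι i = C.iCycles i ≫ C.pOpcycles i := by simp
  have h4 := congr(($h3).hom z)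
  simp only [ModuleCat.hom_comp, LinearMap.comp_apply] at h2 h4
  rw [ha, map_zero] at h2
  rw [map_zero]
  refine h4.trans ((hrange C _).2 (h _ ((hrange D _).1 h2.symm)))

variable {E : Type} [TopologicalSpace E]

/-- Mathlib's singular chain complex of a subspace. -/
noncomputable abbrev chains (A : Set E) : ChainComplex (ModuleCat.{0} (ZMod 2)) ℕ :=
  (TopCat.toSSet.obj (TopCat.of A)).chainComplex (ModuleCat.of (ZMod 2) (ZMod 2))

/-- The underlying function of a singular simplex of a subspace. -/
noncomputable def simplexFun (A : Set E) {n : ℕ} (x : (TopCat.toSSet.obj (TopCat.of A)) _⦋n⦌) :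
    stdSimplex ℝ (Fin (n + 1)) → E :=
  fun t => ((TopCat.toSSetObjEquiv _ _ x t : A) : E)

/-- Mathlib's singular chains as formal sums of functions. -/
noncomputable def toSing (A : Set E) (n : ℕ) :
    (chains A).X n ⟶ ModuleCat.of (ZMod 2) (SingChain (n + 1) E) :=
  Sigma.desc fun x => ModuleCat.ofHom (Finsupp.lsingle (simplexFun A x))

theorem ι_toSing (A : Set E) {n : ℕ} (x : (TopCat.toSSet.obj (TopCat.of A)) _⦋n⦌) :
    SSet.ιChainComplex _ x ≫ toSing A n = ModuleCat.ofHom (Finsupp.lsingle (simplexFun A x)) :=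
  Sigma.ι_desc _ _

theorem simplexFun_δ (A : Set E) {n : ℕ} (x : (TopCat.toSSet.obj (TopCat.of A)) _⦋n + 1⦌)
    (i : Fin (n + 2)) : simplexFun A ((TopCat.toSSet.obj (TopCat.of A)).δ i x) =
      simplexFun A x ∘ stdSimplex.map i.succAbove := rfl

theorem d_toSing (A : Set E) (n : ℕ) : (chains A).d (n + 1) n ≫ toSing A n =
    toSing A (n + 1) ≫ ModuleCat.ofHom (sbd (n + 1)) := by
  refine SSet.chainComplex_hom_ext fun x => ?_
  rw [SSet.ιChainComplex_d_assoc, ← Category.assoc, ι_toSing, Preadditive.sum_comp]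
  refine ModuleCat.hom_ext (LinearMap.ext_ring ?_)
  -- The signs of the alternating sum disappear modulo two.
  have hsign : ∀ (k : ℕ) (f : ModuleCat.of (ZMod 2) (ZMod 2) ⟶
      ModuleCat.of (ZMod 2) (SingChain (n + 1) E)), (-1 : ℤ) ^ k • f = f := by
    intro k f
    rcases Int.even_or_odd k with h | h
    · rw [Even.neg_one_pow (by exact_mod_cast h), one_smul]
    · rw [Odd.neg_one_pow (by exact_mod_cast h), neg_one_smul]
      exact ModuleCat.hom_ext (ZModModule.neg_eq_self f.hom)
  simp only [Preadditive.zsmul_comp, hsign, ι_toSing, simplexFun_δ]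
  rw [ModuleCat.hom_sum, LinearMap.sum_apply, ModuleCat.hom_comp, LinearMap.comp_apply]
  exact (sbd_single _ _).symm

theorem map_toSing {A B : Set E} (h : A ⊆ B) (n : ℕ) :
    (SSet.chainComplexMap (TopCat.toSSet.map
      (TopCat.ofHom (X := A) (Y := B) ⟨Set.inclusion h, continuous_inclusion h⟩)) _).f n ≫
      toSing B n = toSing A n := by
  refine SSet.chainComplex_hom_ext fun x => ?_
  rw [SSet.ι_chainComplexMap_f_assoc, ι_toSing, ι_toSing]
  rfl

theorem continuous_simplexFun (A : Set E) {n : ℕ}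
    (x : (TopCat.toSSet.obj (TopCat.of A)) _⦋n⦌) : Continuous (simplexFun A x) :=
  continuous_subtype_val.comp (TopCat.toSSetObjEquiv _ _ x).continuous

theorem simplexFun_mem (A : Set E) {n : ℕ} (x : (TopCat.toSSet.obj (TopCat.of A)) _⦋n⦌)
    (t : stdSimplex ℝ (Fin (n + 1))) : simplexFun A x t ∈ A :=
  (TopCat.toSSetObjEquiv _ _ x t : A).2

theorem toSing_mem (A : Set E) (n : ℕ) (c : (chains A).X n) :
    (toSing A n).hom c ∈ singIn (n + 1) A := by
  have h : toSing A n ≫ ModuleCat.ofHom (singIn (n + 1) A).mkQ = 0 := by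
    refine SSet.chainComplex_hom_ext fun x => ?_
    rw [← Category.assoc, ι_toSing, comp_zero]
    refine ModuleCat.hom_ext (LinearMap.ext_ring ?_)
    exact (Submodule.Quotient.mk_eq_zero _).2
      (single_mem_supported ⟨continuous_simplexFun A x, simplexFun_mem A x⟩)
  exact (Submodule.Quotient.mk_eq_zero _).1 congr(($h).hom c)

open Classical in
/-- The singular chain given by a function on the standard simplex; it is zero unless the function
is a singular simplex of `A`. -/
noncomputable def simplexChain (A : Set E) (n : ℕ) (σ : stdSimplex ℝ (Fin (n + 1)) → E) :
    (chains A).X n :=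
  if h : Continuous σ ∧ ∀ x, σ x ∈ A then
    (SSet.ιChainComplex (R := ModuleCat.of (ZMod 2) (ZMod 2)) (TopCat.toSSet.obj (TopCat.of A))
      ((TopCat.toSSetObjEquiv (TopCat.of A) (.op ⦋n⦌)).symm
        ⟨fun t => ⟨σ t, h.2 t⟩, h.1.subtype_mk _⟩)).hom 1
  else 0

theorem simplexChain_simplexFun (A : Set E) {n : ℕ}
    (x : (TopCat.toSSet.obj (TopCat.of A)) _⦋n⦌) :
    simplexChain A n (simplexFun A x) =
      (SSet.ιChainComplex (R := ModuleCat.of (ZMod 2) (ZMod 2)) _ x).hom 1 := by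
  have h : Continuous (simplexFun A x) ∧ ∀ t, simplexFun A x t ∈ A :=
    ⟨continuous_simplexFun A x, simplexFun_mem A x⟩
  rw [simplexChain, dif_pos h]
  congr 3

/-- The inverse of `toSing` on the chains of functions that are singular simplices of `A`. -/
noncomputable def ofSing (A : Set E) (n : ℕ) :
    ModuleCat.of (ZMod 2) (SingChain (n + 1) E) ⟶ (chains A).X n :=
  ModuleCat.ofHom (Finsupp.linearCombination (ZMod 2) (simplexChain A n))

theorem toSing_ofSing (A : Set E) (n : ℕ) : toSing A n ≫ ofSing A n = 𝟙 _ := by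
  refine SSet.chainComplex_hom_ext fun x => ?_
  rw [← Category.assoc, ι_toSing, Category.comp_id]
  refine ModuleCat.hom_ext (LinearMap.ext_ring ?_)
  rw [← simplexChain_simplexFun]
  change Finsupp.linearCombination (ZMod 2) (simplexChain A n)
    (Finsupp.single (simplexFun A x) 1) = _
  rw [Finsupp.linearCombination_single, one_smul]

theorem toSing_injective (A : Set E) (n : ℕ) : Function.Injective (toSing A n).hom := by
  intro x y hxy
  have h : ∀ z, (ofSing A n).hom ((toSing A n).hom z) = z :=
    fun z => congr(($(toSing_ofSing A n)).hom z)
  rw [← h x, hxy, h]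

theorem exists_toSing_eq (A : Set E) (n : ℕ) {c : SingChain (n + 1) E}
    (hc : c ∈ singIn (n + 1) A) : ∃ c', (toSing A n).hom c' = c := by
  refine map_mem_of_mem_supported (N := LinearMap.range (toSing A n).hom) LinearMap.id
    (fun σ hσ => ?_) hc
  let x := (TopCat.toSSetObjEquiv (TopCat.of A) (.op ⦋n⦌)).symm
    ⟨fun t => ⟨σ t, hσ.2 t⟩, hσ.1.subtype_mk _⟩
  have hx : simplexFun A x = σ := by
    ext t
    simp only [simplexFun, x, Equiv.apply_symm_apply]
    rfl
  refine ⟨(SSet.ιChainComplex (R := ModuleCat.of (ZMod 2) (ZMod 2)) _ x).hom 1, ?_⟩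
  refine congr(($(ι_toSing A x)).hom 1).trans ?_
  rw [hx]
  rfl

/-- Injectivity in Mathlib's singular homology, expressed by formal sums of functions. -/
theorem homologyInjective_of_exists {A B : Set E} (h : A ⊆ B) (i : ℕ)
    (H : ∀ c ∈ singIn (i + 1) A, ∀ e ∈ singIn (i + 2) B, sbd (i + 1) e = c →
      ∃ e' ∈ singIn (i + 2) A, sbd (i + 1) e' = c) : HomologyInjective (ZMod 2) h i := by
  refine homologyMap_injective (C := chains A) (D := chains B) (SSet.chainComplexMap
    (TopCat.toSSet.map
      (TopCat.ofHom (X := A) (Y := B) ⟨Set.inclusion h, continuous_inclusion h⟩)) _) i ?_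
  rintro x ⟨y, hy⟩
  have hd : ∀ (A : Set E) (z : (chains A).X (i + 1)),
      (toSing A i).hom (((chains A).d (i + 1) i).hom z) = sbd (i + 1) ((toSing A (i + 1)).hom z) :=
    fun A z => congr(($(d_toSing A i)).hom z)
  obtain ⟨e', he', hec⟩ := H _ (toSing_mem A i x) _ (toSing_mem B (i + 1) y) (by
    rw [← hd, hy]
    exact congr(($(map_toSing h i)).hom x))
  obtain ⟨z, rfl⟩ := exists_toSing_eq A (i + 1) he'
  exact ⟨z, toSing_injective A i (by rw [hd, hec])⟩

end Bridge

end Walkup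

theorem mainTheorem2 {V : Type} [Fintype V] [DecidableEq V] (d : ℕ) (hd : d = 2 ∨ 4 ≤ d)
    (K : AbstractSimplicialComplex V) (hK : Walkup.MemWalkupClass d K)
    (hN : Walkup.IsNeighborly 2 K) : Walkup.IsTight K := by
  intro φ c _ i
  have key : ∀ (H : Set (V → ℝ)) (W : Finset V), Convex ℝ H →
      (∀ v ∈ W, Walkup.vertexPoint v ∈ H) →
      (∀ y ∈ Walkup.realization K ∩ H, ∃ v ∈ W, 0 < y v) →
      Walkup.HomologyInjective (ZMod 2)
        (Set.inter_subset_left : Walkup.realization K ∩ H ⊆ Walkup.realization K) i := by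
    intro H W hH hW hHW
    refine Walkup.homologyInjective_of_exists _ i fun c hc e he hec => ?_
    exact Walkup.exists_sbd_eq hH hW hHW
      (fun c hc e he hec => Walkup.exists_obd_eq_of_induced hd hK hN W hc he hec) hc he hec
  have hφ : ∀ y, φ y = ∑ v, y v * φ (Walkup.vertexPoint v) := by
    intro y
    conv_lhs => rw [pi_eq_sum_univ' y]
    rw [map_sum]
    refine Finset.sum_congr rfl fun v _ => ?_
    rw [map_smul, smul_eq_mul]
    rfl
  -- The half-spaces are convex, and a point of the simplex at which `φ` is less than (at most) `c`
  -- has a vertex with this property in its support.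
  constructor
  · refine key {x | φ x < c} (Finset.univ.filter fun v => φ (Walkup.vertexPoint v) < c)
      (convex_halfSpace_lt φ.isLinear c) (fun v hv => by simpa using hv) ?_
    rintro y ⟨⟨hy, -⟩, hyc⟩
    by_contra! h
    refine absurd (show φ y < c from hyc) (not_lt.2 ?_)
    rw [hφ y, ← one_mul c, ← hy.2, Finset.sum_mul]
    refine Finset.sum_le_sum fun v _ => ?_
    by_cases hv : φ (Walkup.vertexPoint v) < c
    · have h0 : y v = 0 := le_antisymm (h v (by simpa using hv)) (hy.1 v)
      rw [h0, zero_mul, zero_mul]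
    · exact mul_le_mul_of_nonneg_left (not_lt.1 hv) (hy.1 v)
  · refine key {x | φ x ≤ c} (Finset.univ.filter fun v => φ (Walkup.vertexPoint v) ≤ c)
      (convex_halfSpace_le φ.isLinear c) (fun v hv => by simpa using hv) ?_
    rintro y ⟨⟨hy, -⟩, hyc⟩
    by_contra! h
    have h0 : ∀ v, y v ≠ 0 → c < φ (Walkup.vertexPoint v) := fun v hv => by
      by_contra! hv'
      exact hv (le_antisymm (h v (by simpa using hv')) (hy.1 v))
    refine absurd (show φ y ≤ c from hyc) (not_le.2 ?_)
    rw [hφ y, ← one_mul c, ← hy.2, Finset.sum_mul]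
    obtain ⟨u, -, hu⟩ := Finset.exists_ne_zero_of_sum_ne_zero (hy.2 ▸ one_ne_zero)
    refine Finset.sum_lt_sum (fun v _ => ?_)
      ⟨u, Finset.mem_univ u, mul_lt_mul_of_pos_left (h0 u hu) ((hy.1 u).lt_of_ne' hu)⟩
    by_cases hv : y v = 0
    · rw [hv, zero_mul, zero_mul]
    · exact mul_le_mul_of_nonneg_left (h0 v hv).le (hy.1 v)
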